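/- Let $K$ be a field and let $A=K[x_1,\ldots,x_n]/Q$, where $\deg x_i=1$ and $Q\neq(1)$ is a homogeneous ideal, with graded maximal ideal $\mathfrak m=\bigoplus_{d>0}A_d$ and $K=A/\mathfrak m$. For a finitely generated graded $A$-module $N$ put $$t_s(N)=\sup\{d : \operatorname{Tor}^A_s(N,K)_d\neq 0\}\quad(\sup\emptyset=-\infty),\qquad \operatorname{reg}_A N=\sup\{t_s(N)-s : s\ge 0\},$$ and let $\operatorname{indeg}(N)=\min\{d : N_d\ne 0\}$ for $N\neq 0$. The module $N$ has an $i$-linear resolution if $\operatorname{reg}_A N=\operatorname{indeg}(N)=i$; the zero module is regarded as having an $i$-linear resolution for every $i$. The algebra $A$ is called Koszul if $\operatorname{reg}_A K=0$. Let $S(\mathfrak m)=\bigoplus_{j\ge0}S^j(\mathfrak m)$ be the symmetric algebra of the $A$-module $\mathfrak m$, and give $S^j(\mathfrak m)$ the grading induced by that of $\mathfrak m$: a product $a_1\cdots a_j$ of homogeneous elements $a_i\in\mathfrak m$ has degree $\sum_i\deg a_i$, so that $S^j(\mathfrak m)$ is generated in degree $j$. If $A$ is Koszul, then for every $j\ge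 1$ the $A$-module $S^j(\mathfrak m)$ has a $j$-linear resolution. -/

import Mathlib

open scoped TensorProduct

noncomputable section

namespace KoszulSym

universe u v

/-- A grading `𝒜` of the `K`-algebra `A` is standard if `A` is, as a graded algebra, a quotient
`K[x₁, …, xₙ] / Q` of a polynomial ring with `deg xᵢ = 1` by a homogeneous ideal `Q`
(the kernel of `f` below): `f` is onto and `𝒜 d` is the image of the forms of degree `d`. -/
def IsStandardGraded {K : Type v} [Field K] {A : Type u} [CommRing A] [Algebra K A]
    (𝒜 : ℕ → Submodule K A) : Prop :=
  ∃ (n : ℕ) (f : MvPolynomial (Fin n) K →ₐ[K] A), Function.Surjective f ∧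
    ∀ d : ℕ, 𝒜 d = (MvPolynomial.homogeneousSubmodule (Fin n) K d).map f.toLinearMap

section Graded

variable {K : Type v} [Field K] {A : Type u} [CommRing A] [Algebra K A]
  (𝒜 : ℕ → Submodule K A) [GradedAlgebra 𝒜]

/-- The graded maximal ideal `𝔪 = ⨁_{d > 0} A_d`. -/
def maxIdeal : Ideal A := (HomogeneousIdeal.irrelevant 𝒜).toIdeal

/-- The degree `d` component of `𝔪`. -/
def maxIdealGrading (d : ℕ) : Submodule K (maxIdeal 𝒜) :=
  (𝒜 d).comap ((maxIdeal 𝒜).subtype.restrictScalars K)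

/-- The residue class field `A / 𝔪`, graded as a quotient of `A`
(for a standard graded algebra it is `K`, concentrated in degree `0`). -/
def residueGrading (d : ℕ) : Submodule K (A ⧸ maxIdeal 𝒜) :=
  (𝒜 d).map (Ideal.Quotient.mkₐ K (maxIdeal 𝒜)).toLinearMap

/-! ### Graded Tor groups

For an `A`-module `N`, the groups `Tor^A_s(N, K)` are the homology of `N ⊗_A P`, where `P` is the
normalized bar resolution `P_s = A ⊗_K 𝔪 ⊗_K ⋯ ⊗_K 𝔪` (`s` factors `𝔪`) of `K` by graded free
`A`-modules.  So `(N ⊗_A P)_s = N ⊗_K 𝔪 ⊗_K ⋯ ⊗_K 𝔪`, with differential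
`d(x ⊗ a₁ ⊗ ⋯ ⊗ aₛ) = a₁x ⊗ a₂ ⊗ ⋯ ⊗ aₛ + ∑_{0<i<s} (-1)^i x ⊗ a₁ ⊗ ⋯ ⊗ aᵢaᵢ₊₁ ⊗ ⋯ ⊗ aₛ`
and with the total degree as internal grading. -/

section Tor

variable (N : Type u) [AddCommGroup N] [Module K N] [Module A N] [IsScalarTower K A N]

/-- `N ⊗_K 𝔪 ⊗_K ⋯ ⊗_K 𝔪` with `s` factors `𝔪`. -/
def bar : ℕ → ModuleCat.{u} K
  | 0 => ModuleCat.of K N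
  | s + 1 => ModuleCat.of K (bar s ⊗[K] maxIdeal 𝒜)

/-- `w, a ↦ w ⊗ a`. -/
def barMk (s : ℕ) : bar 𝒜 N s →ₗ[K] maxIdeal 𝒜 →ₗ[K] bar 𝒜 N (s + 1) :=
  TensorProduct.mk K (bar 𝒜 N s) (maxIdeal 𝒜)

/-- The action of `A` on the last tensor factor. -/
def barAct : (s : ℕ) → A →ₗ[K] (bar 𝒜 N s →ₗ[K] bar 𝒜 N s)
  | 0 => (Algebra.lsmul K K N).toLinearMap
  | s + 1 => (LinearMap.lTensorHom (bar 𝒜 N s) :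
      (maxIdeal 𝒜 →ₗ[K] maxIdeal 𝒜) →ₗ[K] _) ∘ₗ (Algebra.lsmul K K (maxIdeal 𝒜)).toLinearMap

/-- Multiplication of the last two factors, `w ⊗ b ⊗ a ↦ w ⊗ ba` (`x ⊗ a ↦ ax` for `s = 0`). -/
def barMul (s : ℕ) : bar 𝒜 N (s + 1) →ₗ[K] bar 𝒜 N s :=
  TensorProduct.lift (((barAct 𝒜 N s) ∘ₗ (maxIdeal 𝒜).subtype.restrictScalars K).flip)

/-- The differential, `d(w ⊗ a) = d(w) ⊗ a + (-1)^s (w · a)` for `w` with `s` factors `𝔪`. -/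
def barD : (s : ℕ) → bar 𝒜 N (s + 1) →ₗ[K] bar 𝒜 N s
  | 0 => barMul 𝒜 N 0
  | s + 1 =>
      let δ : bar 𝒜 N (s + 2) →ₗ[K] bar 𝒜 N (s + 1) := (barD s).rTensor (maxIdeal 𝒜)
      δ + (-1 : K) ^ (s + 1) • barMul 𝒜 N (s + 1)

/-- The elements killed by the differential (in homological degree `0`, everything). -/
def barKer : (s : ℕ) → Submodule K (bar 𝒜 N s)
  | 0 => ⊤
  | s + 1 => LinearMap.ker (barD 𝒜 N s)

section API

variable {𝒜 N}

set_option linter.unusedSectionVars false in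
lemma bar_induction {s : ℕ} {p : bar 𝒜 N (s + 1) → Prop} (w : bar 𝒜 N (s + 1)) (zero : p 0)
    (mk : ∀ x a, p (barMk 𝒜 N s x a)) (add : ∀ x y, p x → p y → p (x + y)) : p w :=
  TensorProduct.induction_on (motive := p) w zero mk add

lemma barAct_mk (s : ℕ) (w : bar 𝒜 N s) (b : A) (a : maxIdeal 𝒜) :
    barAct 𝒜 N (s + 1) b (barMk 𝒜 N s w a) = barMk 𝒜 N s w (b • a) := rfl

lemma barD_zero_mk (w : bar 𝒜 N 0) (a : maxIdeal 𝒜) :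
    barD 𝒜 N 0 (barMk 𝒜 N 0 w a) = barAct 𝒜 N 0 a w := rfl

lemma barD_succ_mk (s : ℕ) (w : bar 𝒜 N (s + 1)) (a : maxIdeal 𝒜) :
    barD 𝒜 N (s + 1) (barMk 𝒜 N (s + 1) w a) =
      barMk 𝒜 N s (barD 𝒜 N s w) a + (-1 : K) ^ (s + 1) • barAct 𝒜 N (s + 1) a w := rfl

lemma barAct_mul (s : ℕ) (a b : A) (w : bar 𝒜 N s) :
    barAct 𝒜 N s (a * b) w = barAct 𝒜 N s a (barAct 𝒜 N s b w) := by
  cases s with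
  | zero => exact mul_smul a b (show N from w)
  | succ s =>
    induction w using bar_induction with
    | zero => simp only [map_zero]
    | add x y hx hy => simp only [map_add, hx, hy]
    | mk w c => simp only [barAct_mk, mul_smul]

lemma barD_act (s : ℕ) (a : A) (w : bar 𝒜 N (s + 1)) :
    barD 𝒜 N s (barAct 𝒜 N (s + 1) a w) = barAct 𝒜 N s a (barD 𝒜 N s w) := by
  induction w using bar_induction with
  | zero => simp only [map_zero]
  | add x y hx hy => simp only [map_add, hx, hy]
  | mk w c =>
    have key : barAct 𝒜 N s ((a • c : maxIdeal 𝒜) : A) w = barAct 𝒜 N s a (barAct 𝒜 N s c w) :=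
      barAct_mul s a c w
    cases s with
    | zero => rw [barAct_mk, barD_zero_mk, barD_zero_mk, key]
    | succ s => rw [barAct_mk, barD_succ_mk, barD_succ_mk, map_add,
        (barAct 𝒜 N (s + 1) a).map_smul, key, barAct_mk]

/-- The bar construction is a complex. -/
lemma barD_barD (s : ℕ) (w : bar 𝒜 N (s + 2)) :
    barD 𝒜 N s (barD 𝒜 N (s + 1) w) = 0 := by
  induction s with
  | zero =>
    induction w using bar_induction with
    | zero => simp only [map_zero]
    | add x y hx hy => simp only [map_add, hx, hy, add_zero]
    | mk w c =>
      rw [barD_succ_mk 0 w c, map_add, (barD 𝒜 N 0).map_smul, barD_act, barD_zero_mk]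
      simp
  | succ s ih =>
    induction w using bar_induction with
    | zero => simp only [map_zero]
    | add x y hx hy => simp only [map_add, hx, hy, add_zero]
    | mk w c =>
      rw [barD_succ_mk (s + 1) w c, map_add, (barD 𝒜 N (s + 1)).map_smul, barD_act,
        barD_succ_mk s _ c, ih w, map_zero, LinearMap.zero_apply, zero_add, ← add_smul]
      simp [pow_succ]

end API

variable {N}

/-- The component of `N ⊗_K 𝔪 ⊗_K ⋯ ⊗_K 𝔪` of total degree `d`, for a grading `𝒩` of `N`. -/
def barGrading (𝒩 : ℕ → Submodule K N) : (s : ℕ) → ℕ → Submodule K (bar 𝒜 N s)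
  | 0 => 𝒩
  | s + 1 => fun d => ⨆ (e : ℕ) (f : ℕ) (_ : e + f = d),
      Submodule.map₂ (barMk 𝒜 N s)
        (barGrading 𝒩 s e) (maxIdealGrading 𝒜 f)

/-- Cycles of internal degree `d`. -/
def torCycles (𝒩 : ℕ → Submodule K N) (s d : ℕ) : Submodule K (bar 𝒜 N s) :=
  barGrading 𝒜 𝒩 s d ⊓ barKer 𝒜 N s

/-- Boundaries of internal degree `d`. -/
def torBoundaries (𝒩 : ℕ → Submodule K N) (s d : ℕ) : Submodule K (bar 𝒜 N s) :=
  (barGrading 𝒜 𝒩 (s + 1) d).map (barD 𝒜 N s)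

/-- `Tor^A_s(N, K)_d`. -/
abbrev GradedTor (𝒩 : ℕ → Submodule K N) (s d : ℕ) : Type u :=
  torCycles 𝒜 𝒩 s d ⧸ (torBoundaries 𝒜 𝒩 s d).submoduleOf (torCycles 𝒜 𝒩 s d)

/-- `t_s(N) = sup {d | Tor^A_s(N, K)_d ≠ 0}`, which is `-∞` if `Tor^A_s(N, K) = 0`. -/
def topDegree (𝒩 : ℕ → Submodule K N) (s : ℕ) : EReal :=
  ⨆ d ∈ {d : ℕ | Nontrivial (GradedTor 𝒜 𝒩 s d)}, (d : EReal)

/-- The Castelnuovo-Mumford regularity `reg_A N = sup {t_s(N) - s | s ≥ 0}`. -/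
def regularity (𝒩 : ℕ → Submodule K N) : EReal :=
  ⨆ s : ℕ, topDegree 𝒜 𝒩 s - (s : EReal)

/-- `N` has an `i`-linear resolution: `reg_A N = indeg N = i`, where `indeg N` is the least degree
in which `N` is nonzero. The zero module, which has no initial degree, has the zero resolution
and is regarded as having an `i`-linear resolution for every `i`. -/
def HasLinearResolution (𝒩 : ℕ → Submodule K N) (i : ℕ) : Prop :=
  Subsingleton N ∨ (regularity 𝒜 𝒩 = (i : EReal) ∧ IsLeast {d : ℕ | 𝒩 d ≠ ⊥} i)

end Tor

/-- `A` is Koszul if `reg_A K = 0`, where `K = A / 𝔪`. -/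
def IsKoszul : Prop := regularity 𝒜 (residueGrading 𝒜) = 0

/-- The symmetric power `S^j(𝔪)`: the component of degree `j` of the symmetric algebra
`S(𝔪)` over `A`, that is the `A`-span of the `j`-fold products of elements of `𝔪`. -/
abbrev SymPow (j : ℕ) : Submodule A (SymmetricAlgebra A (maxIdeal 𝒜)) :=
  LinearMap.range (SymmetricAlgebra.ι A (maxIdeal 𝒜)) ^ j

/-- The grading of `S^j(𝔪)` induced by the grading of `𝔪`: the component of degree `d` is spanned
by the `b · (a₁ ⋯ aⱼ)` with `b ∈ A`, `aᵢ ∈ 𝔪` homogeneous and `deg b + ∑ᵢ deg aᵢ = d`. -/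
def symPowGrading (j d : ℕ) : Submodule K (SymPow 𝒜 j) :=
  Submodule.span K {w | ∃ (e : ℕ) (b : A) (c : Fin j → ℕ) (a : Fin j → maxIdeal 𝒜),
    b ∈ 𝒜 e ∧ (∀ i, a i ∈ maxIdealGrading 𝒜 (c i)) ∧ e + ∑ i, c i = d ∧
    (w : SymmetricAlgebra A (maxIdeal 𝒜)) = b • ∏ i, SymmetricAlgebra.ι A (maxIdeal 𝒜) (a i)}

end Graded

end KoszulSym

end

/-! Multiplication gives a graded map `S^j(𝔪) → A_{≥j}`, onto because `A` is generated in degree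
one. The heart of the proof (`symMul_injective`) is that this map is injective in degrees above `j`.
Granting this, its kernel lives in degree `j` only, hence is killed by `𝔪` and is a sum of copies of
`K(-j)`. Koszulness bounds the regularity of such a module by `j`. It also gives `reg A_{≥j} ≤ j`,
by induction along `0 → A_{≥j+1} → A_{≥j} → A_j → 0`, starting from the free module `A`. The long
exact sequence of Tor then yields `reg S^j(𝔪) ≤ j` (`regularityLE_symPow_of_injective`).

Injectivity and regularity feed each other in an induction on `j`. The surjection `S^j(𝔪) ⊗_K 𝔪 →
S^{j+1}(𝔪)` kills the boundaries of the bar complex of `S^j(𝔪)`. Lift `w` of degree `d > j + 1` with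
zero product in `A` to `z`. Then `dz ∈ S^j(𝔪)` has the same product in `A`, so `dz = 0` by
injectivity for `j`. Since `reg S^j(𝔪) ≤ j`, `Tor_1(S^j(𝔪), K)_d = 0`; thus `z` is a boundary and `w
= 0`.

The lower bound holds because a nonzero `S^j(𝔪)` is nonzero in degree `j`, its lowest possible
degree, and elements of lowest degree are never boundaries. -/

noncomputable section

namespace KoszulSym

universe u v

set_option linter.unusedSectionVars false

/-! ### Functoriality of the bar construction and its gradings -/

section Functoriality

variable {K : Type v} [Field K] {A : Type u} [CommRing A] [Algebra K A]
  (𝒜 : ℕ → Submodule K A) [GradedAlgebra 𝒜]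
  {N : Type u} [AddCommGroup N] [Module K N] [Module A N] [IsScalarTower K A N]
  {M : Type u} [AddCommGroup M] [Module K M] [Module A M] [IsScalarTower K A M]
  {W : Type u} [AddCommGroup W] [Module K W] [Module A W] [IsScalarTower K A W]

/-- The map induced on the terms of the bar construction by a `K`-linear map. -/
def barMap (g : N →ₗ[K] M) : (s : ℕ) → bar 𝒜 N s →ₗ[K] bar 𝒜 M s
  | 0 => g
  | s + 1 => (barMap g s).rTensor (maxIdeal 𝒜)

variable {𝒜}

lemma barMap_mk (g : N →ₗ[K] M) (s : ℕ) (w : bar 𝒜 N s) (a : maxIdeal 𝒜) :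
    barMap 𝒜 g (s + 1) (barMk 𝒜 N s w a) = barMk 𝒜 M s (barMap 𝒜 g s w) a := rfl

lemma barMap_comp (h : M →ₗ[K] W) (g : N →ₗ[K] M) (s : ℕ) (w : bar 𝒜 N s) :
    barMap 𝒜 (h ∘ₗ g) s w = barMap 𝒜 h s (barMap 𝒜 g s w) := by
  induction s with
  | zero => rfl
  | succ s ih =>
    induction w using bar_induction with
    | zero => simp only [map_zero]
    | add x y hx hy => simp only [map_add, hx, hy]
    | mk w c => rw [barMap_mk, barMap_mk, barMap_mk, ih]

lemma barMap_id (s : ℕ) (w : bar 𝒜 N s) : barMap 𝒜 (LinearMap.id : N →ₗ[K] N) s w = w := by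
  induction s with
  | zero => rfl
  | succ s ih =>
    induction w using bar_induction with
    | zero => simp only [map_zero]
    | add x y hx hy => simp only [map_add, hx, hy]
    | mk w c => rw [barMap_mk, ih]

lemma barMap_add (g h : N →ₗ[K] M) (s : ℕ) (w : bar 𝒜 N s) :
    barMap 𝒜 (g + h) s w = barMap 𝒜 g s w + barMap 𝒜 h s w := by
  induction s with
  | zero => rfl
  | succ s ih =>
    induction w using bar_induction with
    | zero => simp only [map_zero, add_zero]
    | add x y hx hy => simp only [map_add, hx, hy]; abel
    | mk w c => rw [barMap_mk, barMap_mk, barMap_mk, ih, map_add, LinearMap.add_apply]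

lemma barMap_zero (s : ℕ) (w : bar 𝒜 N s) : barMap 𝒜 (0 : N →ₗ[K] M) s w = 0 := by
  have h := barMap_add (0 : N →ₗ[K] M) 0 s w
  rw [add_zero] at h
  exact left_eq_add.mp h

lemma barMap_act (g : N →ₗ[K] M) (hg : ∀ (a : A) x, g (a • x) = a • g x) (s : ℕ) (a : A)
    (w : bar 𝒜 N s) :
    barMap 𝒜 g s (barAct 𝒜 N s a w) = barAct 𝒜 M s a (barMap 𝒜 g s w) := by
  cases s with
  | zero => exact hg a w
  | succ s =>
    induction w using bar_induction with
    | zero => simp only [map_zero]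
    | add x y hx hy => simp only [map_add, hx, hy]
    | mk w c => rw [barAct_mk, barMap_mk, barMap_mk, barAct_mk]

lemma barMap_barD (g : N →ₗ[K] M) (hg : ∀ (a : A) x, g (a • x) = a • g x) (s : ℕ)
    (w : bar 𝒜 N (s + 1)) :
    barMap 𝒜 g s (barD 𝒜 N s w) = barD 𝒜 M s (barMap 𝒜 g (s + 1) w) := by
  induction s with
  | zero =>
    induction w using bar_induction with
    | zero => simp only [map_zero]
    | add x y hx hy => simp only [map_add, hx, hy]
    | mk w c => rw [barD_zero_mk, barMap_mk, barD_zero_mk, barMap_act g hg]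
  | succ s ih =>
    induction w using bar_induction with
    | zero => simp only [map_zero]
    | add x y hx hy => simp only [map_add, hx, hy]
    | mk w c =>
      rw [barD_succ_mk, barMap_mk, barD_succ_mk, map_add, map_smul, barMap_act g hg,
        barMap_mk, ih]

lemma barMap_mem_barKer (g : N →ₗ[K] M) (hg : ∀ (a : A) x, g (a • x) = a • g x) {s : ℕ}
    {w : bar 𝒜 N s} (hw : w ∈ barKer 𝒜 N s) : barMap 𝒜 g s w ∈ barKer 𝒜 M s := by
  cases s with
  | zero => trivial
  | succ s =>
    have hw : barD 𝒜 N s w = 0 := hw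
    change barD 𝒜 M s _ = 0
    rw [← barMap_barD g hg, hw, map_zero]

lemma barD_mem_barKer (s : ℕ) (w : bar 𝒜 N (s + 1)) : barD 𝒜 N s w ∈ barKer 𝒜 N s := by
  cases s with
  | zero => trivial
  | succ s => exact barD_barD s w

lemma barMk_mem {𝒩 : ℕ → Submodule K N} {s e f d : ℕ} (h : e + f = d) {w : bar 𝒜 N s}
    (hw : w ∈ barGrading 𝒜 𝒩 s e) {a : maxIdeal 𝒜} (ha : a ∈ maxIdealGrading 𝒜 f) :
    barMk 𝒜 N s w a ∈ barGrading 𝒜 𝒩 (s + 1) d :=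
  Submodule.mem_iSup_of_mem e <| Submodule.mem_iSup_of_mem f <| Submodule.mem_iSup_of_mem h <|
    Submodule.apply_mem_map₂ _ hw ha

lemma barGrading_succ_le {𝒩 : ℕ → Submodule K N} {s d : ℕ} {P : Submodule K (bar 𝒜 N (s + 1))}
    (h : ∀ e f, e + f = d → ∀ w ∈ barGrading 𝒜 𝒩 s e, ∀ a ∈ maxIdealGrading 𝒜 f,
      barMk 𝒜 N s w a ∈ P) : barGrading 𝒜 𝒩 (s + 1) d ≤ P :=
  iSup_le fun e => iSup_le fun f => iSup_le fun hef =>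
    Submodule.map₂_le.mpr fun w hw a ha => h e f hef w hw a ha

lemma barMap_mem {𝒩 : ℕ → Submodule K N} {ℳ : ℕ → Submodule K M} (c : ℕ) (g : N →ₗ[K] M)
    (hg : ∀ d, ∀ x ∈ 𝒩 d, g x ∈ ℳ (d + c)) (s d : ℕ) {w : bar 𝒜 N s}
    (hw : w ∈ barGrading 𝒜 𝒩 s d) : barMap 𝒜 g s w ∈ barGrading 𝒜 ℳ s (d + c) := by
  induction s generalizing d with
  | zero => exact hg d w hw
  | succ s ih =>
    suffices h : barGrading 𝒜 𝒩 (s + 1) d ≤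
        (barGrading 𝒜 ℳ (s + 1) (d + c)).comap (barMap 𝒜 g (s + 1)) from h hw
    refine barGrading_succ_le fun e f hef w hw a ha => ?_
    rw [Submodule.mem_comap, barMap_mk]
    exact barMk_mem (by omega) (ih e hw) ha

/-- Maps of degree `-c`. Degrees are natural numbers, so components below `c` must be required to
vanish instead of landing in a truncated degree. -/
lemma barMap_mem_sub {𝒩 : ℕ → Submodule K N} {ℳ : ℕ → Submodule K M} (c : ℕ) (g : N →ₗ[K] M)
    (hg : ∀ d, ∀ x ∈ 𝒩 d, if c ≤ d then g x ∈ ℳ (d - c) else g x = 0) (s d : ℕ) {w : bar 𝒜 N s}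
    (hw : w ∈ barGrading 𝒜 𝒩 s d) :
    if c ≤ d then barMap 𝒜 g s w ∈ barGrading 𝒜 ℳ s (d - c) else barMap 𝒜 g s w = 0 := by
  induction s generalizing d with
  | zero => exact hg d w hw
  | succ s ih =>
    split_ifs with hcd
    · suffices h : barGrading 𝒜 𝒩 (s + 1) d ≤
          (barGrading 𝒜 ℳ (s + 1) (d - c)).comap (barMap 𝒜 g (s + 1)) from h hw
      refine barGrading_succ_le fun e f hef w hw a ha => ?_
      rw [Submodule.mem_comap, barMap_mk]
      have := ih e hw
      split_ifs at this with hce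
      · exact barMk_mem (by omega) this ha
      · rw [this, map_zero, LinearMap.zero_apply]
        exact zero_mem _
    · suffices h : barGrading 𝒜 𝒩 (s + 1) d ≤ LinearMap.ker (barMap 𝒜 g (s + 1)) from h hw
      refine barGrading_succ_le fun e f hef w hw a ha => ?_
      rw [LinearMap.mem_ker, barMap_mk]
      have := ih e hw
      rw [if_neg (by omega)] at this
      rw [this, map_zero, LinearMap.zero_apply]

/-- `𝒩` is compatible with the action of the graded ring `A`. -/
def IsGradedSMul (𝒜 : ℕ → Submodule K A) (𝒩 : ℕ → Submodule K N) : Prop :=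
  ∀ ⦃e f : ℕ⦄ ⦃a : A⦄ ⦃x : N⦄, a ∈ 𝒜 f → x ∈ 𝒩 e → a • x ∈ 𝒩 (e + f)

lemma barAct_mem {𝒩 : ℕ → Submodule K N} (h𝒩 : IsGradedSMul 𝒜 𝒩) (s d f : ℕ) {a : A}
    (ha : a ∈ 𝒜 f) {w : bar 𝒜 N s} (hw : w ∈ barGrading 𝒜 𝒩 s d) :
    barAct 𝒜 N s a w ∈ barGrading 𝒜 𝒩 s (d + f) := by
  cases s with
  | zero => exact h𝒩 ha hw
  | succ s =>
    suffices h : barGrading 𝒜 𝒩 (s + 1) d ≤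
        (barGrading 𝒜 𝒩 (s + 1) (d + f)).comap (barAct 𝒜 N (s + 1) a) from h hw
    refine barGrading_succ_le fun e f' hef w hw b hb => ?_
    rw [Submodule.mem_comap, barAct_mk]
    refine barMk_mem (f := f + f') (by omega) hw ?_
    exact SetLike.mul_mem_graded (A := 𝒜) ha (show (b : A) ∈ 𝒜 f' from hb)

lemma barD_mem {𝒩 : ℕ → Submodule K N} (h𝒩 : IsGradedSMul 𝒜 𝒩) (s d : ℕ)
    {w : bar 𝒜 N (s + 1)} (hw : w ∈ barGrading 𝒜 𝒩 (s + 1) d) :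
    barD 𝒜 N s w ∈ barGrading 𝒜 𝒩 s d := by
  induction s generalizing d with
  | zero =>
    suffices h : barGrading 𝒜 𝒩 1 d ≤ (barGrading 𝒜 𝒩 0 d).comap (barD 𝒜 N 0) from h hw
    refine barGrading_succ_le fun e f hef w hw b hb => ?_
    rw [Submodule.mem_comap, barD_zero_mk, ← hef]
    exact barAct_mem h𝒩 0 e f hb hw
  | succ s ih =>
    suffices h : barGrading 𝒜 𝒩 (s + 2) d ≤
      (barGrading 𝒜 𝒩 (s + 1) d).comap (barD 𝒜 N (s + 1)) from h hw
    refine barGrading_succ_le fun e f hef w hw b hb => ?_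
    rw [Submodule.mem_comap, barD_succ_mk]
    refine add_mem (barMk_mem hef (ih e hw) hb) (Submodule.smul_mem _ _ ?_)
    rw [← hef]
    exact barAct_mem h𝒩 (s + 1) e f hb hw

/-- `Tor_s(N, K)_d = 0` for `d > s + j`. -/
def RegularityLE (𝒜 : ℕ → Submodule K A) [GradedAlgebra 𝒜] (𝒩 : ℕ → Submodule K N) (j : ℕ) :
    Prop :=
  ∀ s d, s + j < d → torCycles 𝒜 𝒩 s d ≤ torBoundaries 𝒜 𝒩 s d

/-- A short exact sequence of graded `A`-modules together with a splitting as graded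
`K`-vector spaces. -/
structure SplitSequence (𝒲 : ℕ → Submodule K W) (𝒩 : ℕ → Submodule K N)
    (ℳ : ℕ → Submodule K M) where
  /-- the injection -/
  incl : W →ₗ[K] N
  /-- the surjection -/
  proj : N →ₗ[K] M
  /-- the section -/
  sec : M →ₗ[K] N
  /-- the retraction -/
  retr : N →ₗ[K] W
  incl_smul : ∀ (a : A) x, incl (a • x) = a • incl x
  proj_smul : ∀ (a : A) x, proj (a • x) = a • proj x
  retr_incl : ∀ x, retr (incl x) = x
  proj_sec : ∀ x, proj (sec x) = x
  add_eq : ∀ x, incl (retr x) + sec (proj x) = x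
  incl_mem : ∀ d, ∀ x ∈ 𝒲 d, incl x ∈ 𝒩 d
  proj_mem : ∀ d, ∀ x ∈ 𝒩 d, proj x ∈ ℳ d
  sec_mem : ∀ d, ∀ x ∈ ℳ d, sec x ∈ 𝒩 d
  retr_mem : ∀ d, ∀ x ∈ 𝒩 d, retr x ∈ 𝒲 d

/-! ### Regularity along short exact sequences -/

namespace SplitSequence

variable {𝒲 : ℕ → Submodule K W} {𝒩 : ℕ → Submodule K N} {ℳ : ℕ → Submodule K M}
  (S : SplitSequence (A := A) 𝒲 𝒩 ℳ)

include S

lemma proj_incl (x : W) : S.proj (S.incl x) = 0 := by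
  have h := congrArg S.proj (S.add_eq (S.incl x))
  rw [map_add, S.proj_sec, S.retr_incl] at h
  simpa using h

lemma bar_retr_incl (s : ℕ) (w : bar 𝒜 W s) :
    barMap 𝒜 S.retr s (barMap 𝒜 S.incl s w) = w := by
  rw [← barMap_comp, show S.retr ∘ₗ S.incl = LinearMap.id from LinearMap.ext S.retr_incl,
    barMap_id]

lemma bar_proj_sec (s : ℕ) (w : bar 𝒜 M s) :
    barMap 𝒜 S.proj s (barMap 𝒜 S.sec s w) = w := by
  rw [← barMap_comp, show S.proj ∘ₗ S.sec = LinearMap.id from LinearMap.ext S.proj_sec,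
    barMap_id]

lemma bar_proj_incl (s : ℕ) (w : bar 𝒜 W s) :
    barMap 𝒜 S.proj s (barMap 𝒜 S.incl s w) = 0 := by
  rw [← barMap_comp, show S.proj ∘ₗ S.incl = 0 from LinearMap.ext S.proj_incl, barMap_zero]

/-- Exactness in the middle after tensoring over `K`: the splitting persists in every bar term,
although it need not commute with the differential. -/
lemma bar_incl_retr {s : ℕ} {w : bar 𝒜 N s} (hw : barMap 𝒜 S.proj s w = 0) :
    barMap 𝒜 S.incl s (barMap 𝒜 S.retr s w) = w := by
  have h : barMap 𝒜 (S.incl ∘ₗ S.retr + S.sec ∘ₗ S.proj) s w = w := by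
    rw [show S.incl ∘ₗ S.retr + S.sec ∘ₗ S.proj = LinearMap.id from LinearMap.ext S.add_eq,
      barMap_id]
  rwa [barMap_add, barMap_comp, barMap_comp S.sec, hw, map_zero, add_zero] at h

lemma bar_incl_injective {s : ℕ} : Function.Injective (barMap 𝒜 S.incl s) :=
  Function.LeftInverse.injective (S.bar_retr_incl s)

lemma mem_barKer_of_incl {s : ℕ} {w : bar 𝒜 W s}
    (hw : barMap 𝒜 S.incl s w ∈ barKer 𝒜 N s) : w ∈ barKer 𝒜 W s := by
  cases s with
  | zero => trivial
  | succ s =>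
    have hw : barD 𝒜 N s _ = 0 := hw
    rw [← barMap_barD S.incl S.incl_smul] at hw
    exact S.bar_incl_injective (hw.trans (map_zero _).symm)

/-- Exactness of `Tor_s(W)_d → Tor_s(N)_d → Tor_s(M)_d`, by correcting a cycle with a lifted
boundary until it comes from `W`. -/
lemma regularityLE_middle (h𝒩 : IsGradedSMul 𝒜 𝒩) {j : ℕ} (hW : RegularityLE 𝒜 𝒲 j)
    (hM : RegularityLE 𝒜 ℳ j) : RegularityLE 𝒜 𝒩 j := by
  rintro s d hsd z ⟨hz, hzc⟩
  obtain ⟨u, hu, huz⟩ := hM s d hsd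
    ⟨barMap_mem 0 S.proj S.proj_mem s d hz, barMap_mem_barKer S.proj S.proj_smul hzc⟩
  set u' := barMap 𝒜 S.sec (s + 1) u
  have hu' : u' ∈ barGrading 𝒜 𝒩 (s + 1) d := barMap_mem 0 S.sec S.sec_mem _ d hu
  set y := z - barD 𝒜 N s u'
  have hy : y ∈ barGrading 𝒜 𝒩 s d := sub_mem hz (barD_mem h𝒩 s d hu')
  have hyc : y ∈ barKer 𝒜 N s := sub_mem hzc (barD_mem_barKer s u')
  have hy0 : barMap 𝒜 S.proj s y = 0 := by
    rw [map_sub, barMap_barD S.proj S.proj_smul, S.bar_proj_sec, huz, sub_self]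
  have hyr := S.bar_incl_retr hy0
  obtain ⟨v, hv, hvy⟩ := hW s d hsd ⟨barMap_mem 0 S.retr S.retr_mem s d hy,
    S.mem_barKer_of_incl (by rwa [hyr])⟩
  refine ⟨u' + barMap 𝒜 S.incl (s + 1) v, add_mem hu' (barMap_mem 0 S.incl S.incl_mem _ d hv), ?_⟩
  rw [map_add, ← barMap_barD S.incl S.incl_smul, hvy, hyr, add_sub_cancel]

/-- Exactness of `Tor_{s+1}(M)_d → Tor_s(W)_d → Tor_s(N)_d`. The shift in homological degree on the
left is what costs one: vanishing there needs `d > (s + 1) + j`. -/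
lemma regularityLE_left (h𝒩 : IsGradedSMul 𝒜 𝒩) {j : ℕ} (hN : RegularityLE 𝒜 𝒩 j)
    (hM : RegularityLE 𝒜 ℳ j) : RegularityLE 𝒜 𝒲 (j + 1) := by
  rintro s d hsd z ⟨hz, hzc⟩
  obtain ⟨u, hu, huz⟩ := hN s d (by omega)
    ⟨barMap_mem 0 S.incl S.incl_mem s d hz, barMap_mem_barKer S.incl S.incl_smul hzc⟩
  have hpu : barMap 𝒜 S.proj (s + 1) u ∈ barKer 𝒜 M (s + 1) := by
    change barD 𝒜 M s _ = 0
    rw [← barMap_barD S.proj S.proj_smul, huz, S.bar_proj_incl]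
  obtain ⟨v, hv, hvu⟩ := hM (s + 1) d (by omega)
    ⟨barMap_mem 0 S.proj S.proj_mem _ d hu, hpu⟩
  set v' := barMap 𝒜 S.sec (s + 2) v
  have hv' : v' ∈ barGrading 𝒜 𝒩 (s + 2) d := barMap_mem 0 S.sec S.sec_mem _ d hv
  set y := u - barD 𝒜 N (s + 1) v'
  have hy : y ∈ barGrading 𝒜 𝒩 (s + 1) d := sub_mem hu (barD_mem h𝒩 (s + 1) d hv')
  have hy0 : barMap 𝒜 S.proj (s + 1) y = 0 := by
    rw [map_sub, barMap_barD S.proj S.proj_smul, S.bar_proj_sec, hvu, sub_self]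
  refine ⟨barMap 𝒜 S.retr (s + 1) y, barMap_mem 0 S.retr S.retr_mem _ d hy, ?_⟩
  apply S.bar_incl_injective
  rw [barMap_barD S.incl S.incl_smul, S.bar_incl_retr hy0, map_sub, barD_barD, sub_zero, huz]

end SplitSequence

end Functoriality

/-! ### Standard graded algebras and the splitting `A = A₀ ⊕ 𝔪` -/

section Ring

variable {K : Type v} [Field K] {A : Type u} [CommRing A] [Algebra K A]
  {𝒜 : ℕ → Submodule K A}

lemma IsStandardGraded.exists_algebraMap_eq (hA : IsStandardGraded 𝒜) {a : A} (ha : a ∈ 𝒜 0) :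
    ∃ k : K, algebraMap K A k = a := by
  obtain ⟨n, f, -, hf⟩ := hA
  rw [hf 0, MvPolynomial.homogeneousSubmodule_zero] at ha
  obtain ⟨p, hp, rfl⟩ := ha
  obtain ⟨k, rfl⟩ := Submodule.mem_one.mp hp
  exact ⟨k, (f.commutes k).symm⟩

lemma IsStandardGraded.le_mul (hA : IsStandardGraded 𝒜) (d : ℕ) :
    𝒜 (d + 1) ≤ 𝒜 1 * 𝒜 d := by
  obtain ⟨n, f, -, hf⟩ := hA
  rw [hf, hf, hf, ← Submodule.map_mul, ← MvPolynomial.homogeneousSubmodule_one_pow _ (d + 1),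
    ← MvPolynomial.homogeneousSubmodule_one_pow _ d, pow_succ']

variable (𝒜) [GradedAlgebra 𝒜]

lemma mem_maxIdeal_iff {a : A} : a ∈ maxIdeal 𝒜 ↔ GradedAlgebra.proj 𝒜 0 a = 0 :=
  HomogeneousIdeal.mem_irrelevant_iff 𝒜 a

variable {𝒜}

lemma proj_mem (i : ℕ) (a : A) : GradedAlgebra.proj 𝒜 i a ∈ 𝒜 i :=
  SetLike.coe_mem _

lemma proj_of_mem {i : ℕ} {a : A} (ha : a ∈ 𝒜 i) : GradedAlgebra.proj 𝒜 i a = a :=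
  DirectSum.decompose_of_mem_same 𝒜 ha

lemma proj_of_mem_ne {i j : ℕ} {a : A} (ha : a ∈ 𝒜 i) (hij : i ≠ j) :
    GradedAlgebra.proj 𝒜 j a = 0 :=
  DirectSum.decompose_of_mem_ne 𝒜 ha hij

lemma proj_mem_of_mem (i : ℕ) {d : ℕ} {a : A} (ha : a ∈ 𝒜 d) : GradedAlgebra.proj 𝒜 i a ∈ 𝒜 d := by
  by_cases h : d = i
  · exact h ▸ proj_mem d a
  · rw [proj_of_mem_ne ha h]; exact zero_mem _

lemma mem_maxIdeal_of_mem {d : ℕ} (hd : 0 < d) {a : A} (ha : a ∈ 𝒜 d) : a ∈ maxIdeal 𝒜 :=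
  (mem_maxIdeal_iff 𝒜).mpr (proj_of_mem_ne ha (by omega))

lemma eq_zero_of_mem_maxIdealGrading_zero {a : maxIdeal 𝒜} (ha : a ∈ maxIdealGrading 𝒜 0) :
    a = 0 := by
  have h := (mem_maxIdeal_iff 𝒜).mp a.2
  rw [proj_of_mem (show (a : A) ∈ 𝒜 0 from ha)] at h
  exact Subtype.ext h

variable (𝒜)

/-- The projection of `A` onto `𝔪` along `A₀`. -/
def toMaxIdeal : A →ₗ[K] maxIdeal 𝒜 :=
  LinearMap.codRestrict ((maxIdeal 𝒜).restrictScalars K)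
    (LinearMap.id - GradedAlgebra.proj 𝒜 0) fun a => by
      change _ ∈ maxIdeal 𝒜
      rw [mem_maxIdeal_iff, LinearMap.sub_apply, map_sub, proj_of_mem (proj_mem 0 a)]
      exact sub_self _

variable {𝒜}

lemma coe_toMaxIdeal (a : A) : (toMaxIdeal 𝒜 a : A) = a - GradedAlgebra.proj 𝒜 0 a := rfl

lemma toMaxIdeal_mem {d : ℕ} {a : A} (ha : a ∈ 𝒜 d) : toMaxIdeal 𝒜 a ∈ maxIdealGrading 𝒜 d :=
  sub_mem ha (proj_mem_of_mem 0 ha)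

lemma toMaxIdeal_coe (a : maxIdeal 𝒜) : toMaxIdeal 𝒜 a = a := by
  ext
  rw [coe_toMaxIdeal, (mem_maxIdeal_iff 𝒜).mp a.2, sub_zero]

lemma IsStandardGraded.exists_sub_mem (hA : IsStandardGraded 𝒜) (a : A) :
    ∃ k : K, a - algebraMap K A k ∈ maxIdeal 𝒜 := by
  obtain ⟨k, hk⟩ := hA.exists_algebraMap_eq (proj_mem 0 a)
  exact ⟨k, hk ▸ (toMaxIdeal 𝒜 a).2⟩

end Ring

/-! ### Acyclicity of the bar resolution -/

section Free

variable {K : Type v} [Field K] {A : Type u} [CommRing A] [Algebra K A]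
  (𝒜 : ℕ → Submodule K A) [GradedAlgebra 𝒜]

variable {𝒜} in
/-- The identification of `A` with the term of degree `0` of its bar construction. -/
def barZero : A →ₗ[K] bar 𝒜 A 0 := LinearMap.id

/-- The contracting homotopy `a ⊗ a₁ ⊗ ⋯ ⊗ aₛ ↦ 1 ⊗ a ⊗ a₁ ⊗ ⋯ ⊗ aₛ` of the bar resolution. -/
def barHomotopy : (s : ℕ) → bar 𝒜 A s →ₗ[K] bar 𝒜 A (s + 1)
  | 0 => (barMk 𝒜 A 0 (barZero 1)) ∘ₗ toMaxIdeal 𝒜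
  | s + 1 => (barHomotopy s).rTensor (maxIdeal 𝒜)

variable {𝒜}

lemma barAct_barZero (a b : A) : barAct 𝒜 A 0 a (barZero b) = barZero (a * b) := rfl

lemma barHomotopy_zero (a : A) :
    barHomotopy 𝒜 0 (barZero a) = barMk 𝒜 A 0 (barZero 1) (toMaxIdeal 𝒜 a) := rfl

lemma barHomotopy_mk (s : ℕ) (w : bar 𝒜 A s) (a : maxIdeal 𝒜) :
    barHomotopy 𝒜 (s + 1) (barMk 𝒜 A s w a) = barMk 𝒜 A (s + 1) (barHomotopy 𝒜 s w) a := rfl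

/-- Only valid when the last factor is an `𝔪`: on the term `A` itself the homotopy projects to `𝔪`
and is not `A`-linear. Hence the separate base case in `barD_barHomotopy_succ`. -/
lemma barHomotopy_act (s : ℕ) (b : A) (w : bar 𝒜 A (s + 1)) :
    barHomotopy 𝒜 (s + 1) (barAct 𝒜 A (s + 1) b w) =
      barAct 𝒜 A (s + 2) b (barHomotopy 𝒜 (s + 1) w) := by
  induction w using bar_induction with
  | zero => simp only [map_zero]
  | add x y hx hy => simp only [map_add, hx, hy]
  | mk w c => rw [barAct_mk, barHomotopy_mk, barHomotopy_mk, barAct_mk]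

lemma barD_barHomotopy_zero (a : A) :
    barD 𝒜 A 0 (barHomotopy 𝒜 0 (barZero a)) = barZero (toMaxIdeal 𝒜 a : A) := by
  rw [barHomotopy_zero, barD_zero_mk, barAct_barZero, mul_one]

lemma barD_barHomotopy_succ (hA : IsStandardGraded 𝒜) (s : ℕ) (w : bar 𝒜 A (s + 1)) :
    barD 𝒜 A (s + 1) (barHomotopy 𝒜 (s + 1) w) + barHomotopy 𝒜 s (barD 𝒜 A s w) = w := by
  induction s with
  | zero =>
    induction w using bar_induction with
    | zero => simp only [map_zero, add_zero]
    | add x y hx hy => simp only [map_add]; rw [add_add_add_comm, hx, hy]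
    | mk w c =>
      obtain ⟨x, hx⟩ : ∃ x : A, barZero x = w := ⟨w, rfl⟩
      rw [← hx]
      obtain ⟨k, hk⟩ := hA.exists_algebraMap_eq (proj_mem (𝒜 := 𝒜) 0 x)
      -- The homotopy forgets the constant part `k` of `x`. It is recovered from `c * x`, whose
      -- projection to `𝔪` keeps the term `k • c`.
      have hw : x = (toMaxIdeal 𝒜 x : A) + k • (1 : A) := by
        rw [coe_toMaxIdeal, ← hk, ← Algebra.algebraMap_eq_smul_one, sub_add_cancel]
      have hc : toMaxIdeal 𝒜 ((c : A) * x) = (c : A) • toMaxIdeal 𝒜 x + k • c := by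
        have : (c : A) * x = (((c : A) • toMaxIdeal 𝒜 x + k • c : maxIdeal 𝒜) : A) := by
          conv_lhs => rw [hw]
          rw [mul_add, mul_smul_comm, mul_one]
          rfl
        rw [this, toMaxIdeal_coe]
      have h2 : barMk 𝒜 A 0 (barZero x) c = barMk 𝒜 A 0 (barZero (toMaxIdeal 𝒜 x : A)) c +
          k • barMk 𝒜 A 0 (barZero 1) c := by
        rw [← LinearMap.smul_apply, ← map_smul, ← map_smul, ← LinearMap.add_apply, ← map_add,
          ← map_add, ← hw]
      rw [barHomotopy_mk, barD_succ_mk, barD_zero_mk, barAct_barZero, barD_barHomotopy_zero,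
        barHomotopy_zero, barHomotopy_zero, hc, h2, barAct_mk, map_add, map_smul (_ : maxIdeal 𝒜 →ₗ[K] _) k c]
      simp only [zero_add, pow_one, neg_smul, one_smul]
      abel
  | succ s ih =>
    induction w using bar_induction with
    | zero => simp only [map_zero, add_zero]
    | add x y hx hy => simp only [map_add]; rw [add_add_add_comm, hx, hy]
    | mk w c =>
      rw [barHomotopy_mk, barD_succ_mk, barD_succ_mk, map_add, map_smul, barHomotopy_mk,
        barHomotopy_act, add_add_add_comm, ← LinearMap.add_apply, ← map_add, ih w, ← add_smul]
      simp [pow_succ]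

lemma barHomotopy_mem (s d : ℕ) {w : bar 𝒜 A s} (hw : w ∈ barGrading 𝒜 𝒜 s d) :
    barHomotopy 𝒜 s w ∈ barGrading 𝒜 𝒜 (s + 1) d := by
  induction s generalizing d with
  | zero =>
    exact barMk_mem (zero_add d) (show (1 : A) ∈ 𝒜 0 from SetLike.GradedOne.one_mem)
      (toMaxIdeal_mem hw)
  | succ s ih =>
    suffices h : barGrading 𝒜 𝒜 (s + 1) d ≤
        (barGrading 𝒜 𝒜 (s + 2) d).comap (barHomotopy 𝒜 (s + 1)) from h hw
    refine barGrading_succ_le fun e f hef w hw a ha => ?_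
    rw [Submodule.mem_comap, barHomotopy_mk]
    exact barMk_mem hef (ih e hw) ha

/-- For `s > 0` the homotopy exhibits every cycle as a boundary. For `s = 0` it does so for elements
of `𝔪`, which suffices in degrees `d > 0`. -/
lemma regularityLE_self (hA : IsStandardGraded 𝒜) : RegularityLE 𝒜 𝒜 0 := by
  rintro s d hsd z ⟨hz, hzc⟩
  refine ⟨barHomotopy 𝒜 s z, barHomotopy_mem s d hz, ?_⟩
  cases s with
  | zero =>
    obtain ⟨x, hx⟩ : ∃ x : A, barZero x = z := ⟨z, rfl⟩
    rw [← hx] at hz ⊢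
    rw [barD_barHomotopy_zero]
    exact congrArg Subtype.val (toMaxIdeal_coe ⟨x, mem_maxIdeal_of_mem (𝒜 := 𝒜) (by omega) hz⟩)
  | succ s =>
    have h := barD_barHomotopy_succ hA s z
    rwa [show barD 𝒜 A s z = 0 from hzc, map_zero, add_zero] at h

end Free

/-! ### Modules killed by the maximal ideal -/

section Trivial

variable {K : Type v} [Field K] {A : Type u} [CommRing A] [Algebra K A]
  {𝒜 : ℕ → Submodule K A} [GradedAlgebra 𝒜]
  {N : Type u} [AddCommGroup N] [Module K N] [Module A N] [IsScalarTower K A N]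
  {M : Type u} [AddCommGroup M] [Module K M] [Module A M] [IsScalarTower K A M]

lemma map_smul_of_maxIdeal_smul (hA : IsStandardGraded 𝒜)
    (hN : ∀ a ∈ maxIdeal 𝒜, ∀ x : N, a • x = 0) (hM : ∀ a ∈ maxIdeal 𝒜, ∀ x : M, a • x = 0)
    (g : N →ₗ[K] M) (a : A) (x : N) : g (a • x) = a • g x := by
  obtain ⟨k, hk⟩ := hA.exists_sub_mem a
  obtain ⟨b, rfl⟩ : ∃ b, a = b + algebraMap K A k := ⟨_, (sub_add_cancel _ _).symm⟩
  rw [add_sub_cancel_right] at hk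
  rw [add_smul, add_smul, hN b hk, hM b hk, algebraMap_smul, algebraMap_smul, zero_add, zero_add,
    map_smul]

lemma maxIdeal_smul_residue (a : A) (ha : a ∈ maxIdeal 𝒜) (x : A ⧸ maxIdeal 𝒜) : a • x = 0 := by
  obtain ⟨b, rfl⟩ := Ideal.Quotient.mk_surjective x
  exact Ideal.Quotient.eq_zero_iff_mem.mpr (Ideal.mul_mem_right b _ ha)

lemma residue_bijective [Nontrivial A] (hA : IsStandardGraded 𝒜) :
    Function.Bijective (Algebra.linearMap K (A ⧸ maxIdeal 𝒜)) := by
  constructor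
  · refine (injective_iff_map_eq_zero _).mpr fun k hk => ?_
    have h1 : algebraMap K A k ∈ maxIdeal 𝒜 := Ideal.Quotient.eq_zero_iff_mem.mp hk
    have h2 : algebraMap K A k ∈ 𝒜 0 := SetLike.algebraMap_mem_graded 𝒜 k
    rw [mem_maxIdeal_iff, proj_of_mem h2] at h1
    exact (map_eq_zero_iff _ (algebraMap K A).injective).mp h1
  · intro x
    obtain ⟨b, rfl⟩ := Ideal.Quotient.mk_surjective x
    obtain ⟨k, hk⟩ := hA.exists_sub_mem b
    exact ⟨k, (Ideal.Quotient.mk_eq_mk_iff_sub_mem _ _).mpr (by simpa using neg_mem hk)⟩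

lemma residueGrading_zero (hA : IsStandardGraded 𝒜) (x : A ⧸ maxIdeal 𝒜) :
    x ∈ residueGrading 𝒜 0 := by
  obtain ⟨b, rfl⟩ := Ideal.Quotient.mk_surjective x
  obtain ⟨k, hk⟩ := hA.exists_sub_mem b
  exact ⟨algebraMap K A k, SetLike.algebraMap_mem_graded 𝒜 k,
    (Ideal.Quotient.mk_eq_mk_iff_sub_mem _ _).mpr (by simpa using neg_mem hk)⟩

lemma eq_zero_of_mem_residueGrading {d : ℕ} (hd : 0 < d) {x : A ⧸ maxIdeal 𝒜}
    (hx : x ∈ residueGrading 𝒜 d) : x = 0 := by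
  obtain ⟨a, ha, rfl⟩ := hx
  exact Ideal.Quotient.eq_zero_iff_mem.mpr (mem_maxIdeal_of_mem hd ha)

/-- A locally finite decomposition of the identity stays one on the bar terms, since each tensor is
a finite sum. This replaces commutation of Tor with possibly infinite direct sums. Allowing all
larger `F'` lets finite sets be merged. -/
lemma exists_finset_sum_barMap {ι : Type*} (g : ι → N →ₗ[K] N)
    (hg : ∀ x, ∃ F : Finset ι, ∀ F', F ⊆ F' → ∑ i ∈ F', g i x = x) (s : ℕ) (w : bar 𝒜 N s) :
    ∃ F : Finset ι, ∀ F', F ⊆ F' → ∑ i ∈ F', barMap 𝒜 (g i) s w = w := by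
  classical
  induction s with
  | zero => exact hg w
  | succ s ih =>
    induction w using bar_induction with
    | zero => exact ⟨∅, fun F' _ => by simp only [map_zero, Finset.sum_const_zero]⟩
    | add x y hx hy =>
      obtain ⟨F, hF⟩ := hx
      obtain ⟨G, hG⟩ := hy
      refine ⟨F ∪ G, fun F' h => ?_⟩
      simp only [map_add]
      rw [Finset.sum_add_distrib, hF F' (Finset.union_subset_left h),
        hG F' (Finset.union_subset_right h)]
    | mk w c =>
      obtain ⟨F, hF⟩ := ih w
      refine ⟨F, fun F' h => ?_⟩
      simp only [barMap_mk]
      rw [← LinearMap.sum_apply, ← map_sum, hF F' h]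

/-- A `K`-basis makes `N` a direct sum of copies of `K(-j)`: each coordinate of a cycle is a cycle
for `K` in degree `d - j > s`, hence bounds, and the bounding chains are reassembled. -/
lemma regularityLE_of_maxIdeal_smul [Nontrivial A] (hA : IsStandardGraded 𝒜)
    (hK : RegularityLE 𝒜 (residueGrading 𝒜) 0) {𝒩 : ℕ → Submodule K N} {j : ℕ}
    (hN : ∀ a ∈ maxIdeal 𝒜, ∀ x : N, a • x = 0) (h𝒩 : ∀ x, x ∈ 𝒩 j)
    (h𝒩' : ∀ d ≠ j, ∀ x ∈ 𝒩 d, x = 0) : RegularityLE 𝒜 𝒩 j := by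
  rintro s d hsd z ⟨hz, hzc⟩
  let e := LinearEquiv.ofBijective _ (residue_bijective hA)
  let b := Module.Basis.ofVectorSpace K N
  let p := fun i => e.toLinearMap ∘ₗ b.coord i
  let q := fun i => LinearMap.toSpanSingleton K N (b i) ∘ₗ e.symm.toLinearMap
  have hp : ∀ i (a : A) x, p i (a • x) = a • p i x := fun i =>
    map_smul_of_maxIdeal_smul hA hN maxIdeal_smul_residue _
  have hq : ∀ i (a : A) x, q i (a • x) = a • q i x := fun i =>
    map_smul_of_maxIdeal_smul hA maxIdeal_smul_residue hN _
  have hpd : ∀ i d, ∀ x ∈ 𝒩 d,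
      if j ≤ d then p i x ∈ residueGrading 𝒜 (d - j) else p i x = 0 := by
    intro i d x hx
    by_cases hd : d = j
    · rw [if_pos hd.ge, hd, Nat.sub_self]
      exact residueGrading_zero hA _
    · rw [h𝒩' d hd x hx, map_zero]
      split_ifs
      exacts [zero_mem _, rfl]
  have hqd : ∀ i d, ∀ x ∈ residueGrading 𝒜 d, q i x ∈ 𝒩 (d + j) := by
    intro i d x hx
    rcases Nat.eq_zero_or_pos d with rfl | hd
    · rw [zero_add]; exact h𝒩 _
    · rw [eq_zero_of_mem_residueGrading hd hx, map_zero]; exact zero_mem _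
  obtain ⟨F, hF⟩ := exists_finset_sum_barMap (𝒜 := 𝒜) (fun i => q i ∘ₗ p i) (fun x => by
    refine ⟨(b.repr x).support, fun F' h => ?_⟩
    conv_rhs => rw [← b.linearCombination_repr x, Finsupp.linearCombination_apply,
      Finsupp.sum_of_support_subset _ h _ (fun i _ => zero_smul K (b i))]
    refine Finset.sum_congr rfl fun i _ => ?_
    simp [p, q]) s z
  have hu : ∀ i, ∃ u ∈ barGrading 𝒜 (residueGrading 𝒜) (s + 1) (d - j),
      barD 𝒜 _ s u = barMap 𝒜 (p i) s z := fun i => by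
    have h := barMap_mem_sub j (p i) (hpd i) s d hz
    rw [if_pos (by omega)] at h
    exact hK s (d - j) (by omega) ⟨h, barMap_mem_barKer _ (hp i) hzc⟩
  choose u hu hu' using hu
  refine ⟨∑ i ∈ F, barMap 𝒜 (q i) (s + 1) (u i), sum_mem fun i _ => ?_, ?_⟩
  · have h := barMap_mem j (q i) (hqd i) (s + 1) (d - j) (hu i)
    rwa [Nat.sub_add_cancel (by omega)] at h
  · rw [map_sum]
    conv_rhs => rw [← hF F subset_rfl]
    refine Finset.sum_congr rfl fun i _ => ?_
    rw [← barMap_barD _ (hq i), hu', barMap_comp]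

/-- Regularity does not increase on passing to a graded retract. -/
lemma RegularityLE.of_retract {𝒩 : ℕ → Submodule K N} {ℳ : ℕ → Submodule K M} {j : ℕ}
    (hM : RegularityLE 𝒜 ℳ j) (g : N →ₗ[K] M) (h : M →ₗ[K] N)
    (hg : ∀ (a : A) x, g (a • x) = a • g x) (hh : ∀ (a : A) x, h (a • x) = a • h x)
    (hgd : ∀ d, ∀ x ∈ 𝒩 d, g x ∈ ℳ d) (hhd : ∀ d, ∀ x ∈ ℳ d, h x ∈ 𝒩 d)
    (hhg : h ∘ₗ g = LinearMap.id) : RegularityLE 𝒜 𝒩 j := by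
  rintro s d hsd z ⟨hz, hzc⟩
  obtain ⟨u, hu, huz⟩ := hM s d hsd ⟨barMap_mem 0 g hgd s d hz, barMap_mem_barKer g hg hzc⟩
  refine ⟨barMap 𝒜 h (s + 1) u, barMap_mem 0 h hhd _ d hu, ?_⟩
  rw [← barMap_barD h hh, huz, ← barMap_comp, hhg, barMap_id]

end Trivial

/-! ### Split sequences from retractions -/

section Retraction

variable {K : Type v} [Field K] {A : Type u} [CommRing A] [Algebra K A]
  {N : Type u} [AddCommGroup N] [Module K N] [Module A N] [IsScalarTower K A N]
  {W : Type u} [AddCommGroup W] [Module K W] [Module A W] [IsScalarTower K A W]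

/-- The section of `N → N / W` complementary to a `K`-linear retraction `N → W`. -/
def sectionOfRetraction (incl : W →ₗ[A] N) (retr : N →ₗ[K] W)
    (retr_incl : ∀ x, retr (incl x) = x) : (N ⧸ LinearMap.range incl) →ₗ[K] N :=
  ((LinearMap.range incl).restrictScalars K).liftQ
      (LinearMap.id - incl.restrictScalars K ∘ₗ retr) (by
        rintro _ ⟨x, rfl⟩
        simp [retr_incl]) ∘ₗ
    (Submodule.Quotient.restrictScalarsEquiv K (LinearMap.range incl)).symm.toLinearMap

lemma sectionOfRetraction_mk (incl : W →ₗ[A] N) (retr : N →ₗ[K] W)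
    (retr_incl : ∀ x, retr (incl x) = x) (x : N) :
    sectionOfRetraction incl retr retr_incl (Submodule.Quotient.mk x) = x - incl (retr x) := rfl

/-- The exact sequence `0 → W → N → N / W → 0` given by a graded injection with a graded
`K`-linear retraction. -/
def SplitSequence.ofRetraction {𝒲 : ℕ → Submodule K W} {𝒩 : ℕ → Submodule K N}
    (incl : W →ₗ[A] N) (retr : N →ₗ[K] W) (retr_incl : ∀ x, retr (incl x) = x)
    (incl_mem : ∀ d, ∀ x ∈ 𝒲 d, incl x ∈ 𝒩 d) (retr_mem : ∀ d, ∀ x ∈ 𝒩 d, retr x ∈ 𝒲 d) :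
    SplitSequence (A := A) 𝒲 𝒩
      (fun d => (𝒩 d).map ((LinearMap.range incl).mkQ.restrictScalars K)) where
  incl := incl.restrictScalars K
  proj := (LinearMap.range incl).mkQ.restrictScalars K
  sec := sectionOfRetraction incl retr retr_incl
  retr := retr
  incl_smul a x := map_smul incl a x
  proj_smul a x := map_smul (LinearMap.range incl).mkQ a x
  retr_incl := retr_incl
  proj_sec x := by
    obtain ⟨y, rfl⟩ := Submodule.Quotient.mk_surjective _ x
    refine (Submodule.Quotient.eq _).mpr ?_
    rw [sectionOfRetraction_mk, sub_sub_cancel_left]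
    exact neg_mem ⟨_, rfl⟩
  add_eq x := add_sub_cancel (incl (retr x)) x
  incl_mem := incl_mem
  proj_mem d x hx := Submodule.mem_map_of_mem hx
  sec_mem d := by
    rintro _ ⟨y, hy, rfl⟩
    exact sub_mem hy (incl_mem d _ (retr_mem d y hy))
  retr_mem := retr_mem

end Retraction

/-! ### Regularity of the truncations of the ring -/

section Truncation

variable {K : Type v} [Field K] {A : Type u} [CommRing A] [Algebra K A]
  (𝒜 : ℕ → Submodule K A) [GradedAlgebra 𝒜]

/-- The ideal `⨁_{d ≥ j} A_d`. -/
def truncIdeal (j : ℕ) : Ideal A where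
  carrier := {a | ∀ i < j, GradedAlgebra.proj 𝒜 i a = 0}
  add_mem' ha hb i hi := by rw [map_add, ha i hi, hb i hi, add_zero]
  zero_mem' i _ := map_zero _
  smul_mem' b a ha := by
    induction b using DirectSum.Decomposition.inductionOn 𝒜 with
    | zero => intro i _; rw [zero_smul, map_zero]
    | homogeneous b =>
      rename_i k
      intro i hi
      by_cases hk : k ≤ i
      · have h := ha (i - k) (by omega)
        rw [GradedAlgebra.proj_apply] at h
        rw [GradedAlgebra.proj_apply, smul_eq_mul,
          DirectSum.coe_decompose_mul_of_left_mem_of_le 𝒜 b.2 hk, h, mul_zero]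
      · rw [GradedAlgebra.proj_apply, smul_eq_mul,
          DirectSum.coe_decompose_mul_of_left_mem_of_not_le 𝒜 b.2 hk]
    | add b c hb hc => intro i hi; rw [add_smul, map_add, hb i hi, hc i hi, add_zero]

/-- The degree `d` component of `⨁_{d ≥ j} A_d`. -/
def truncGrading (j d : ℕ) : Submodule K (truncIdeal 𝒜 j) :=
  (𝒜 d).comap ((truncIdeal 𝒜 j).subtype.restrictScalars K)

variable {𝒜}

lemma mem_truncIdeal {j d : ℕ} (h : j ≤ d) {a : A} (ha : a ∈ 𝒜 d) : a ∈ truncIdeal 𝒜 j :=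
  fun _ hi => proj_of_mem_ne ha (by omega)

lemma truncIdeal_succ_le (j : ℕ) : truncIdeal 𝒜 (j + 1) ≤ truncIdeal 𝒜 j :=
  fun _ ha i hi => ha i (by omega)

lemma eq_zero_of_mem_truncGrading {j d : ℕ} (h : d < j) {a : truncIdeal 𝒜 j}
    (ha : a ∈ truncGrading 𝒜 j d) : a = 0 := by
  have h := a.2 d h
  rw [proj_of_mem (show (a : A) ∈ 𝒜 d from ha)] at h
  exact Subtype.ext h

lemma sub_proj_mem_truncIdeal {j : ℕ} {a : A} (ha : a ∈ truncIdeal 𝒜 j) :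
    a - GradedAlgebra.proj 𝒜 j a ∈ truncIdeal 𝒜 (j + 1) := fun i hi => by
  rw [map_sub]
  rcases Nat.lt_succ_iff_lt_or_eq.mp hi with h | rfl
  · rw [ha i h, proj_of_mem_ne (proj_mem j a) (by omega), sub_zero]
  · rw [proj_of_mem (proj_mem i a), sub_self]

/-- The degree `j` part of `a * b` is `a₀ * b_j`, and `a₀ = 0`. This makes the quotient `A_j` a
module killed by `𝔪`. -/
lemma mul_mem_truncIdeal_succ {j : ℕ} {a b : A} (ha : a ∈ maxIdeal 𝒜) (hb : b ∈ truncIdeal 𝒜 j) :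
    a * b ∈ truncIdeal 𝒜 (j + 1) := by
  have h1 : a * (b - GradedAlgebra.proj 𝒜 j b) ∈ truncIdeal 𝒜 (j + 1) :=
    Ideal.mul_mem_left _ _ (sub_proj_mem_truncIdeal hb)
  have h2 : a * GradedAlgebra.proj 𝒜 j b ∈ truncIdeal 𝒜 (j + 1) := fun i hi => by
    by_cases hj : j ≤ i
    · obtain rfl : i = j := by omega
      rw [GradedAlgebra.proj_apply,
        DirectSum.coe_decompose_mul_of_right_mem_of_le 𝒜 (proj_mem i b) le_rfl, Nat.sub_self]
      exact mul_eq_zero_of_left ((mem_maxIdeal_iff 𝒜).mp ha) _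
    · rw [GradedAlgebra.proj_apply,
        DirectSum.coe_decompose_mul_of_right_mem_of_not_le 𝒜 (proj_mem j b) hj]
  have h := add_mem h1 h2
  rwa [← mul_add, sub_add_cancel] at h

lemma isGradedSMul_truncGrading (j : ℕ) : IsGradedSMul 𝒜 (truncGrading 𝒜 j) := by
  intro e f a x ha hx
  rw [add_comm]
  exact SetLike.mul_mem_graded (A := 𝒜) ha (show (x : A) ∈ 𝒜 e from hx)

variable (𝒜) in
/-- The sequence `0 → ⨁_{d > j} A_d → ⨁_{d ≥ j} A_d → A_j → 0`. -/
def truncSequence (j : ℕ) :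
    SplitSequence (A := A) (truncGrading 𝒜 (j + 1)) (truncGrading 𝒜 j)
      (fun d => (truncGrading 𝒜 j d).map
        ((LinearMap.range (Submodule.inclusion (truncIdeal_succ_le (𝒜 := 𝒜) j))).mkQ.restrictScalars
          K)) :=
  .ofRetraction _
    (LinearMap.codRestrict ((truncIdeal 𝒜 (j + 1)).restrictScalars K)
      ((LinearMap.id - GradedAlgebra.proj 𝒜 j) ∘ₗ (truncIdeal 𝒜 j).subtype.restrictScalars K)
      fun a => by
        change (a : A) - GradedAlgebra.proj 𝒜 j a ∈ truncIdeal 𝒜 (j + 1)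
        exact sub_proj_mem_truncIdeal a.2)
    (fun x => by
      ext
      change (x : A) - GradedAlgebra.proj 𝒜 j x = x
      rw [x.2 j (by omega), sub_zero])
    (fun _ _ hx => hx) (fun d x hx => by
      change (x : A) - GradedAlgebra.proj 𝒜 j x ∈ 𝒜 d
      exact sub_mem hx (proj_mem_of_mem j hx))

lemma regularityLE_truncIdeal [Nontrivial A] (hA : IsStandardGraded 𝒜)
    (hK : RegularityLE 𝒜 (residueGrading 𝒜) 0) (j : ℕ) :
    RegularityLE 𝒜 (truncGrading 𝒜 j) j := by
  induction j with
  | zero =>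
    exact (regularityLE_self hA).of_retract ((truncIdeal 𝒜 0).subtype.restrictScalars K)
      (LinearMap.codRestrict ((truncIdeal 𝒜 0).restrictScalars K) LinearMap.id
        fun a i hi => absurd hi (by omega))
      (fun _ _ => rfl) (fun _ _ => rfl) (fun _ _ hx => hx) (fun _ _ hx => hx) rfl
  | succ j ih =>
    refine (truncSequence 𝒜 j).regularityLE_left (isGradedSMul_truncGrading j) ih ?_
    refine regularityLE_of_maxIdeal_smul hA hK ?_ ?_ ?_
    · intro a ha x
      obtain ⟨y, rfl⟩ := Submodule.Quotient.mk_surjective _ x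
      exact (Submodule.Quotient.mk_eq_zero _).mpr
        ⟨⟨_, mul_mem_truncIdeal_succ ha y.2⟩, rfl⟩
    · intro x
      obtain ⟨y, rfl⟩ := Submodule.Quotient.mk_surjective _ x
      refine ⟨⟨_, mem_truncIdeal le_rfl (proj_mem j (y : A))⟩, proj_mem j (y : A), ?_⟩
      refine (Submodule.Quotient.eq _).mpr (neg_mem_iff.mp ?_)
      exact ⟨⟨_, sub_proj_mem_truncIdeal y.2⟩, Subtype.ext (neg_sub _ _).symm⟩
    · rintro d hd _ ⟨y, hy, rfl⟩
      rcases lt_or_gt_of_ne hd with h | h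
      · rw [eq_zero_of_mem_truncGrading h hy, map_zero]
      · exact (Submodule.Quotient.mk_eq_zero _).mpr ⟨⟨_, mem_truncIdeal h hy⟩, rfl⟩

end Truncation

/-! ### Symmetric powers and the multiplication map to the ring -/

section SymmetricPower

variable {K : Type v} [Field K] {A : Type u} [CommRing A] [Algebra K A]
  {𝒜 : ℕ → Submodule K A} [GradedAlgebra 𝒜]

lemma mem_iSup_maxIdealGrading (a : maxIdeal 𝒜) : a ∈ ⨆ d, maxIdealGrading 𝒜 d := by
  suffices h : ∀ b : A, toMaxIdeal 𝒜 b ∈ ⨆ d, maxIdealGrading 𝒜 d by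
    simpa only [toMaxIdeal_coe] using h a
  intro b
  induction b using DirectSum.Decomposition.inductionOn 𝒜 with
  | zero => rw [map_zero]; exact zero_mem _
  | homogeneous b => exact Submodule.mem_iSup_of_mem _ (toMaxIdeal_mem b.2)
  | add b c hb hc => rw [map_add]; exact add_mem hb hc

lemma mem_iSup_truncGrading {j : ℕ} (a : truncIdeal 𝒜 j) : a ∈ ⨆ d, truncGrading 𝒜 j d := by
  classical
  have key : ∀ i, GradedAlgebra.proj 𝒜 i (a : A) ∈ truncIdeal 𝒜 j := fun i => by
    by_cases hi : i < j
    · rw [a.2 i hi]; exact zero_mem _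
    · exact mem_truncIdeal (by omega) (proj_mem i _)
  have h : a = ∑ i ∈ (DirectSum.decompose 𝒜 (a : A)).support,
      (⟨GradedAlgebra.proj 𝒜 i (a : A), key i⟩ : truncIdeal 𝒜 j) := by
    ext
    rw [AddSubmonoidClass.coe_finsetSum]
    exact (DirectSum.sum_support_decompose 𝒜 (a : A)).symm
  rw [h]
  exact sum_mem fun i _ => Submodule.mem_iSup_of_mem i (proj_mem i (a : A))

lemma prod_mem_symPow {j : ℕ} (a : Fin j → maxIdeal 𝒜) :
    ∏ i, SymmetricAlgebra.ι A (maxIdeal 𝒜) (a i) ∈ SymPow 𝒜 j := by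
  induction j with
  | zero =>
    rw [Finset.univ_eq_empty, Finset.prod_empty, SymPow, pow_zero]
    exact Submodule.mem_one.mpr ⟨1, map_one _⟩
  | succ j ih =>
    rw [Fin.prod_univ_succ, SymPow, pow_succ']
    exact Submodule.mul_mem_mul ⟨a 0, rfl⟩ (ih _)

lemma symPowGrading_le {j d : ℕ} {P : Submodule K (SymPow 𝒜 j)}
    (h : ∀ (e : ℕ) (b : A) (c : Fin j → ℕ) (a : Fin j → maxIdeal 𝒜), b ∈ 𝒜 e →
      (∀ i, a i ∈ maxIdealGrading 𝒜 (c i)) → e + ∑ i, c i = d →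
      (⟨b • ∏ i, SymmetricAlgebra.ι A (maxIdeal 𝒜) (a i),
        Submodule.smul_mem _ b (prod_mem_symPow a)⟩ : SymPow 𝒜 j) ∈ P) :
    symPowGrading 𝒜 j d ≤ P := by
  refine Submodule.span_le.mpr ?_
  rintro ⟨w, hw⟩ ⟨e, b, c, a, hb, ha, hd, rfl⟩
  exact h e b c a hb ha hd

lemma smul_prod_mem_symPowGrading {j d e : ℕ} {b : A} {c : Fin j → ℕ} {a : Fin j → maxIdeal 𝒜}
    (hb : b ∈ 𝒜 e) (ha : ∀ i, a i ∈ maxIdealGrading 𝒜 (c i)) (hd : e + ∑ i, c i = d)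
    {w : SymPow 𝒜 j}
    (hw : (w : SymmetricAlgebra A (maxIdeal 𝒜)) =
      b • ∏ i, SymmetricAlgebra.ι A (maxIdeal 𝒜) (a i)) : w ∈ symPowGrading 𝒜 j d :=
  Submodule.subset_span ⟨e, b, c, a, hb, ha, hd, hw⟩

lemma isGradedSMul_symPowGrading (j : ℕ) : IsGradedSMul 𝒜 (symPowGrading 𝒜 j) := by
  intro e f r x hr hx
  suffices h : symPowGrading 𝒜 j e ≤
      (symPowGrading 𝒜 j (e + f)).comap (Algebra.lsmul K K (SymPow 𝒜 j) r) from h hx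
  refine symPowGrading_le fun e' b c a hb ha hd => ?_
  exact smul_prod_mem_symPowGrading (SetLike.mul_mem_graded (A := 𝒜) hr hb) ha (by omega)
    (smul_smul r b _)

/-- With total degree below `j`, one of the `j` factors has degree `0`, and `𝔪` vanishes there. -/
lemma eq_zero_of_mem_symPowGrading {j d : ℕ} (hdj : d < j) {w : SymPow 𝒜 j}
    (hw : w ∈ symPowGrading 𝒜 j d) : w = 0 := by
  suffices h : symPowGrading 𝒜 j d ≤ ⊥ from (Submodule.mem_bot K).mp (h hw)
  refine symPowGrading_le fun e b c a hb ha hd => ?_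
  obtain ⟨i, hi⟩ : ∃ i, c i = 0 := by
    by_contra! h
    have : ∑ i : Fin j, 1 ≤ ∑ i, c i :=
      Finset.sum_le_sum fun i _ => Nat.one_le_iff_ne_zero.mpr (h i)
    rw [Finset.sum_const, Finset.card_fin, smul_eq_mul, mul_one] at this
    omega
  rw [Submodule.mem_bot]
  ext
  have hai : a i = 0 := eq_zero_of_mem_maxIdealGrading_zero (hi ▸ ha i)
  change b • ∏ i, SymmetricAlgebra.ι A (maxIdeal 𝒜) (a i) = 0
  rw [Finset.prod_eq_zero (Finset.mem_univ i) (by rw [hai, map_zero]), smul_zero]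

variable (𝒜) in
/-- The multiplication `S^j(𝔪) × 𝔪 → S^{j+1}(𝔪)`. -/
def symCons (j : ℕ) : SymPow 𝒜 j →ₗ[K] maxIdeal 𝒜 →ₗ[K] SymPow 𝒜 (j + 1) :=
  LinearMap.mk₂ K (fun x a => ⟨SymmetricAlgebra.ι A (maxIdeal 𝒜) a * x, by
      rw [SymPow, pow_succ']
      exact Submodule.mul_mem_mul ⟨a, rfl⟩ x.2⟩)
    (fun x y a => Subtype.ext (mul_add _ _ _))
    (fun k x a => Subtype.ext (mul_smul_comm k _ (x : SymmetricAlgebra A (maxIdeal 𝒜))))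
    (fun x a b => Subtype.ext (by
      change SymmetricAlgebra.ι A (maxIdeal 𝒜) (a + b) * _ = _
      rw [map_add, add_mul]; rfl))
    (fun k x a => Subtype.ext (by
      change SymmetricAlgebra.ι A (maxIdeal 𝒜) (k • a) * _ =
        k • (SymmetricAlgebra.ι A (maxIdeal 𝒜) a * _)
      rw [← algebraMap_smul A k a, map_smul, smul_mul_assoc, algebraMap_smul]))

lemma coe_symCons (j : ℕ) (x : SymPow 𝒜 j) (a : maxIdeal 𝒜) :
    (symCons 𝒜 j x a : SymmetricAlgebra A (maxIdeal 𝒜)) =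
      SymmetricAlgebra.ι A (maxIdeal 𝒜) a * x := rfl

lemma symCons_mem {j d f : ℕ} {x : SymPow 𝒜 j} (hx : x ∈ symPowGrading 𝒜 j d) {a : maxIdeal 𝒜}
    (ha : a ∈ maxIdealGrading 𝒜 f) : symCons 𝒜 j x a ∈ symPowGrading 𝒜 (j + 1) (d + f) := by
  suffices h : symPowGrading 𝒜 j d ≤
      (symPowGrading 𝒜 (j + 1) (d + f)).comap ((symCons 𝒜 j).flip a) from h hx
  refine symPowGrading_le fun e b c a' hb ha' hd => ?_
  refine smul_prod_mem_symPowGrading (c := Fin.cons f c) (a := Fin.cons a a') hb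
    (fun i => Fin.cases ha ha' i) (by rw [Fin.sum_univ_succ]; simp; omega) ?_
  rw [Fin.prod_univ_succ]
  exact mul_smul_comm b (SymmetricAlgebra.ι A (maxIdeal 𝒜) a)
    (∏ i, SymmetricAlgebra.ι A (maxIdeal 𝒜) (a' i))

lemma mem_iSup_symPowGrading {j : ℕ} (w : SymPow 𝒜 j) : w ∈ ⨆ d, symPowGrading 𝒜 j d := by
  obtain ⟨w, hw⟩ := w
  induction j generalizing w with
  | zero =>
    obtain ⟨a, ha⟩ := Submodule.mem_one.mp (show w ∈ (1 : Submodule A _) by simpa using hw)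
    suffices h : ∀ a : A, (⟨a • 1, Submodule.smul_mem _ a (prod_mem_symPow Fin.elim0)⟩ :
        SymPow 𝒜 0) ∈ ⨆ d, symPowGrading 𝒜 0 d by
      convert h a using 2
      rw [← ha, Algebra.algebraMap_eq_smul_one]
    intro a
    induction a using DirectSum.Decomposition.inductionOn 𝒜 with
    | zero =>
      rw [show (⟨(0 : A) • 1, Submodule.smul_mem _ 0 (prod_mem_symPow Fin.elim0)⟩ : SymPow 𝒜 0) = 0
        from Subtype.ext (zero_smul A _)]
      exact zero_mem _
    | homogeneous b =>
      exact Submodule.mem_iSup_of_mem _ (smul_prod_mem_symPowGrading (c := Fin.elim0)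
        (a := Fin.elim0) b.2 (fun i => i.elim0) rfl rfl)
    | add b c hb hc => convert add_mem hb hc; exact add_smul b c _
  | succ j ih =>
    have hw' : w ∈ LinearMap.range (SymmetricAlgebra.ι A (maxIdeal 𝒜)) * SymPow 𝒜 j := by
      rwa [SymPow, ← pow_succ']
    induction hw' using Submodule.mul_induction_on' with
    | mem_mul_mem m hm n hn =>
      obtain ⟨a, rfl⟩ := hm
      have h : symCons 𝒜 j ⟨n, hn⟩ a ∈ Submodule.map₂ (symCons 𝒜 j)
          (⨆ d, symPowGrading 𝒜 j d) (⨆ d, maxIdealGrading 𝒜 d) :=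
        Submodule.apply_mem_map₂ _ (ih n hn) (mem_iSup_maxIdealGrading a)
      simp_rw [Submodule.map₂_iSup_left, Submodule.map₂_iSup_right] at h
      refine (iSup_le fun d => iSup_le fun f => ?_ : _ ≤ ⨆ d, symPowGrading 𝒜 (j + 1) d) h
      exact (Submodule.map₂_le.mpr fun x hx a ha => symCons_mem hx ha).trans
        (le_iSup (symPowGrading 𝒜 (j + 1)) (d + f))
    | add x hx y hy hx' hy' =>
      have e := pow_succ' (LinearMap.range (SymmetricAlgebra.ι A (maxIdeal 𝒜))) j
      exact add_mem (hx' (by rwa [SymPow, e])) (hy' (by rwa [SymPow, e]))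

variable (𝒜) in
/-- The map `S^j(𝔪) ⊗ 𝔪 → S^{j+1}(𝔪)`. -/
def barToSymPow (j : ℕ) : bar 𝒜 (SymPow 𝒜 j) 1 →ₗ[K] SymPow 𝒜 (j + 1) :=
  TensorProduct.lift (symCons 𝒜 j)

variable (𝒜) in
/-- The identification of `S^j(𝔪)` with the term of degree `0` of its bar construction. -/
def symPowToBar (j : ℕ) : SymPow 𝒜 j →ₗ[K] bar 𝒜 (SymPow 𝒜 j) 0 := LinearMap.id

variable (𝒜) in
/-- The inverse of `symPowToBar`. -/
def barToSymPowZero (j : ℕ) : bar 𝒜 (SymPow 𝒜 j) 0 →ₗ[K] SymPow 𝒜 j := LinearMap.id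

lemma barToSymPow_mk (j : ℕ) (x : SymPow 𝒜 j) (a : maxIdeal 𝒜) :
    barToSymPow 𝒜 j (barMk 𝒜 (SymPow 𝒜 j) 0 (symPowToBar 𝒜 j x) a) = symCons 𝒜 j x a := rfl

lemma barAct_symPowToBar (j : ℕ) (a : A) (x : SymPow 𝒜 j) :
    barAct 𝒜 (SymPow 𝒜 j) 0 a (symPowToBar 𝒜 j x) = symPowToBar 𝒜 j (a • x) := rfl

/-- On `x ⊗ a ⊗ c` the boundary is `ax ⊗ c - x ⊗ ca`, and both terms have the same image because the
product in `S(𝔪)` is `A`-bilinear and `c • a = a • c` in `𝔪`. -/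
lemma barToSymPow_barD (j : ℕ) (z : bar 𝒜 (SymPow 𝒜 j) 2) :
    barToSymPow 𝒜 j (barD 𝒜 (SymPow 𝒜 j) 1 z) = 0 := by
  induction z using bar_induction with
  | zero => simp only [map_zero]
  | add x y hx hy => simp only [map_add, hx, hy, add_zero]
  | mk w c =>
    induction w using bar_induction with
    | zero => simp only [map_zero, LinearMap.zero_apply]
    | add x y hx hy => simp only [map_add, LinearMap.add_apply, hx, hy, add_zero]
    | mk x a =>
      obtain ⟨x', hx⟩ : ∃ x' : SymPow 𝒜 j, symPowToBar 𝒜 j x' = x := ⟨x, rfl⟩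
      rw [← hx, barD_succ_mk, barD_zero_mk, barAct_symPowToBar, barAct_mk, map_add,
        (barToSymPow 𝒜 j).map_smul, barToSymPow_mk, barToSymPow_mk]
      ext
      have hac : (c : A) • a = (a : A) • c := Subtype.ext (mul_comm (c : A) a)
      have key : SymmetricAlgebra.ι A (maxIdeal 𝒜) c *
          ((a : A) • (x' : SymmetricAlgebra A (maxIdeal 𝒜))) =
          SymmetricAlgebra.ι A (maxIdeal 𝒜) ((c : A) • a) * x' := by
        rw [hac, map_smul, smul_mul_assoc, mul_smul_comm]
      rw [zero_add, pow_one, neg_smul, one_smul, ← sub_eq_add_neg]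
      exact sub_eq_zero.mpr key

lemma exists_barToSymPow_eq {j d : ℕ} {w : SymPow 𝒜 (j + 1)}
    (hw : w ∈ symPowGrading 𝒜 (j + 1) d) :
    ∃ z ∈ barGrading 𝒜 (symPowGrading 𝒜 j) 1 d, barToSymPow 𝒜 j z = w := by
  suffices h : symPowGrading 𝒜 (j + 1) d ≤
    (barGrading 𝒜 (symPowGrading 𝒜 j) 1 d).map (barToSymPow 𝒜 j) from h hw
  refine symPowGrading_le fun e b c a hb ha hd => ?_
  rw [Fin.sum_univ_succ] at hd
  set x : SymPow 𝒜 j := ⟨b • ∏ i, SymmetricAlgebra.ι A (maxIdeal 𝒜) (a i.succ),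
        Submodule.smul_mem _ b (prod_mem_symPow _)⟩
  refine ⟨barMk 𝒜 (SymPow 𝒜 j) 0 (symPowToBar 𝒜 j x) (a 0),
    barMk_mem (e := e + ∑ i : Fin j, c i.succ) (by omega)
      (smul_prod_mem_symPowGrading (w := x) hb (fun i => ha i.succ) rfl rfl) (ha 0), ?_⟩
  rw [barToSymPow_mk]
  ext
  refine (mul_smul_comm b _ _).trans (congrArg (b • ·) ?_)
  exact (Fin.prod_univ_succ fun i => SymmetricAlgebra.ι A (maxIdeal 𝒜) (a i)).symm

variable (𝒜) in
/-- The multiplication map `S(𝔪) → A`. -/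
def symMul : SymmetricAlgebra A (maxIdeal 𝒜) →ₐ[A] A :=
  SymmetricAlgebra.lift (maxIdeal 𝒜).subtype

lemma symMul_ι (a : maxIdeal 𝒜) : symMul 𝒜 (SymmetricAlgebra.ι A (maxIdeal 𝒜) a) = a :=
  SymmetricAlgebra.lift_ι_apply _ a

lemma symMul_mem {j d : ℕ} {w : SymPow 𝒜 j} (hw : w ∈ symPowGrading 𝒜 j d) :
    symMul 𝒜 w ∈ 𝒜 d := by
  suffices h : symPowGrading 𝒜 j d ≤ (𝒜 d).comap
    (((symMul 𝒜).toLinearMap ∘ₗ (SymPow 𝒜 j).subtype).restrictScalars K) from h hw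
  refine symPowGrading_le fun e b c a hb ha hd => ?_
  change symMul 𝒜 (b • ∏ i, SymmetricAlgebra.ι A (maxIdeal 𝒜) (a i)) ∈ 𝒜 d
  rw [map_smul, map_prod, ← hd]
  simp_rw [symMul_ι]
  exact SetLike.mul_mem_graded (A := 𝒜) hb (SetLike.prod_mem_graded _ _ _ fun i _ => ha i)

lemma exists_symMul_eq (hA : IsStandardGraded 𝒜) (j d : ℕ) (hjd : j ≤ d) {x : A} (hx : x ∈ 𝒜 d) :
    ∃ w ∈ symPowGrading 𝒜 j d, symMul 𝒜 w = x := by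
  induction j generalizing d x with
  | zero =>
    refine ⟨⟨x • 1, Submodule.smul_mem _ x (prod_mem_symPow Fin.elim0)⟩,
      smul_prod_mem_symPowGrading (c := Fin.elim0) (a := Fin.elim0) hx (fun i => i.elim0) rfl rfl,
      ?_⟩
    rw [map_smul, map_one, smul_eq_mul, mul_one]
  | succ j ih =>
    obtain ⟨d, rfl⟩ : ∃ d', d = d' + 1 := ⟨d - 1, by omega⟩
    suffices h : 𝒜 1 * 𝒜 d ≤ (symPowGrading 𝒜 (j + 1) (d + 1)).map
      (((symMul 𝒜).toLinearMap ∘ₗ (SymPow 𝒜 (j + 1)).subtype).restrictScalars K) from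
        h (hA.le_mul d hx)
    refine Submodule.mul_le.mpr fun a ha y hy => ?_
    obtain ⟨w, hw, rfl⟩ := ih d (by omega) hy
    refine ⟨symCons 𝒜 j w ⟨a, mem_maxIdeal_of_mem one_pos ha⟩, symCons_mem hw ha, ?_⟩
    change symMul 𝒜 (SymmetricAlgebra.ι A (maxIdeal 𝒜) _ * _) = _
    rw [map_mul, symMul_ι]

lemma symMul_mem_truncIdeal {j : ℕ} (w : SymPow 𝒜 j) : symMul 𝒜 w ∈ truncIdeal 𝒜 j := by
  have h := mem_iSup_symPowGrading w
  induction h using Submodule.iSup_induction' with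
  | mem d w hw =>
    by_cases hd : d < j
    · rw [eq_zero_of_mem_symPowGrading hd hw, ZeroMemClass.coe_zero, map_zero]
      exact zero_mem _
    · exact mem_truncIdeal (by omega) (symMul_mem hw)
  | zero => rw [ZeroMemClass.coe_zero, map_zero]; exact zero_mem _
  | add x y _ _ hx hy => rw [Submodule.coe_add, map_add]; exact add_mem hx hy

variable (𝒜) in
/-- The multiplication map `S^j(𝔪) → ⨁_{d ≥ j} A_d`. -/
def symPowMul (j : ℕ) : SymPow 𝒜 j →ₗ[A] truncIdeal 𝒜 j :=
  LinearMap.codRestrict _ ((symMul 𝒜).toLinearMap ∘ₗ (SymPow 𝒜 j).subtype) symMul_mem_truncIdeal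

/-- Right inverses are chosen degree by degree for `d ≥ j`; below `j` the source vanishes and the
zero map serves. -/
lemma exists_section_symPowMul (hA : IsStandardGraded 𝒜) (j : ℕ) :
    ∃ σ : truncIdeal 𝒜 j →ₗ[K] SymPow 𝒜 j, (∀ x, symPowMul 𝒜 j (σ x) = x) ∧
      ∀ d, ∀ x ∈ truncGrading 𝒜 j d, σ x ∈ symPowGrading 𝒜 j d := by
  have h : ∀ d, ∃ g : 𝒜 d →ₗ[K] SymPow 𝒜 j, (∀ x, g x ∈ symPowGrading 𝒜 j d) ∧
      (j ≤ d → ∀ x, symMul 𝒜 (g x) = x) := by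
    intro d
    by_cases hd : j ≤ d
    · let p : symPowGrading 𝒜 j d →ₗ[K] 𝒜 d := LinearMap.codRestrict _
        (((symMul 𝒜).toLinearMap ∘ₗ (SymPow 𝒜 j).subtype).restrictScalars K ∘ₗ
          (symPowGrading 𝒜 j d).subtype) fun w => symMul_mem w.2
      obtain ⟨g, hg⟩ := p.exists_rightInverse_of_surjective (LinearMap.range_eq_top.mpr fun x => by
        obtain ⟨w, hw, hwx⟩ := exists_symMul_eq hA j d hd x.2
        exact ⟨⟨w, hw⟩, Subtype.ext hwx⟩)
      exact ⟨(symPowGrading 𝒜 j d).subtype ∘ₗ g, fun x => (g x).2,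
        fun _ x => congrArg Subtype.val (LinearMap.congr_fun hg x)⟩
    · exact ⟨0, fun _ => zero_mem _, fun h => absurd h hd⟩
  choose g hg hg' using h
  let τ : A →ₗ[K] SymPow 𝒜 j :=
    DirectSum.toModule K ℕ _ g ∘ₗ (DirectSum.decomposeLinearEquiv 𝒜).toLinearMap
  have hτ : ∀ d (x : A) (hx : x ∈ 𝒜 d), τ x = g d ⟨x, hx⟩ := fun d x hx => by
    change DirectSum.toModule K ℕ _ g (DirectSum.decompose 𝒜 x) = _
    rw [DirectSum.decompose_of_mem 𝒜 hx]
    exact DirectSum.toModule_lof K d _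
  refine ⟨τ ∘ₗ (truncIdeal 𝒜 j).subtype.restrictScalars K, fun x => ?_, fun d x hx => ?_⟩
  · have h := mem_iSup_truncGrading x
    induction h using Submodule.iSup_induction' with
    | mem d x hx =>
      by_cases hd : d < j
      · rw [eq_zero_of_mem_truncGrading hd hx, map_zero, map_zero]
      · ext
        change symMul 𝒜 (τ x) = x
        rw [hτ d x hx, hg' d (by omega)]
    | zero => rw [map_zero, map_zero]
    | add x y _ _ hx hy => rw [map_add, map_add, hx, hy]
  · change τ x ∈ _
    rw [hτ d x hx]
    exact hg d _

/-- The kernel of `S^j(𝔪) → A_{≥j}` is concentrated in degree `j`, so both ends of the sequence have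
regularity at most `j`. -/
lemma regularityLE_symPow_of_injective [Nontrivial A] (hA : IsStandardGraded 𝒜)
    (hK : RegularityLE 𝒜 (residueGrading 𝒜) 0) {j : ℕ}
    (hj : ∀ d, j < d → ∀ w ∈ symPowGrading 𝒜 j d, symMul 𝒜 w = 0 → w = 0) :
    RegularityLE 𝒜 (symPowGrading 𝒜 j) j := by
  obtain ⟨σ, hσ, hσd⟩ := exists_section_symPowMul hA j
  -- The graded projection onto the kernel along the section `σ`.
  let ρ : SymPow 𝒜 j →ₗ[K] SymPow 𝒜 j :=
    LinearMap.id - σ ∘ₗ (symPowMul 𝒜 j).restrictScalars K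
  have hρ : ∀ x, ρ x = x - σ (symPowMul 𝒜 j x) := fun x => rfl
  have hρk : ∀ x, symPowMul 𝒜 j (ρ x) = 0 := fun x => by rw [hρ, map_sub, hσ, sub_self]
  have hρd : ∀ d, ∀ x ∈ symPowGrading 𝒜 j d, ρ x ∈ symPowGrading 𝒜 j d := fun d x hx =>
    sub_mem hx (hσd d _ (symMul_mem hx))
  have hz : ∀ x, symPowMul 𝒜 j x = 0 → ∀ d, j < d → x ∈ symPowGrading 𝒜 j d → x = 0 :=
    fun x hx d hd hxd => hj d hd x hxd (congrArg Subtype.val hx)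
  have hρj : ∀ x, ρ x ∈ symPowGrading 𝒜 j j := fun x => by
    have h := mem_iSup_symPowGrading x
    induction h using Submodule.iSup_induction' with
    | mem d x hx =>
      rcases lt_trichotomy d j with h | rfl | h
      · rw [eq_zero_of_mem_symPowGrading h (hρd d x hx)]; exact zero_mem _
      · exact hρd d x hx
      · rw [hz _ (hρk x) d h (hρd d x hx)]; exact zero_mem _
    | zero => rw [map_zero]; exact zero_mem _
    | add x y _ _ hx hy => rw [map_add]; exact add_mem hx hy
  have hker : ∀ x, symPowMul 𝒜 j x = 0 → x ∈ symPowGrading 𝒜 j j := fun x hx => by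
    have h := hρj x
    rwa [hρ, hx, map_zero, sub_zero] at h
  let r : SymPow 𝒜 j →ₗ[K] LinearMap.ker (symPowMul 𝒜 j) :=
    LinearMap.codRestrict ((LinearMap.ker (symPowMul 𝒜 j)).restrictScalars K) ρ hρk
  let i : LinearMap.ker (symPowMul 𝒜 j) →ₗ[K] SymPow 𝒜 j :=
    (LinearMap.ker (symPowMul 𝒜 j)).subtype.restrictScalars K
  have hri : ∀ x, r (i x) = x := fun x => Subtype.ext (by
    change ρ x = x
    rw [hρ, show symPowMul 𝒜 j x = 0 from x.2, map_zero, sub_zero])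
  let S : SplitSequence (A := A) (W := LinearMap.ker (symPowMul 𝒜 j)) (fun d => (symPowGrading 𝒜 j d).comap i)
      (symPowGrading 𝒜 j) (truncGrading 𝒜 j) :=
    ⟨i, (symPowMul 𝒜 j).restrictScalars K, σ, r, fun _ _ => rfl,
      fun a x => map_smul (symPowMul 𝒜 j) a x, hri, hσ,
      fun x => sub_add_cancel x (σ (symPowMul 𝒜 j x)), fun _ _ hx => hx,
      fun _ _ hx => symMul_mem hx, hσd, fun d x hx => hρd d x hx⟩
  refine S.regularityLE_middle (isGradedSMul_symPowGrading j)
    (regularityLE_of_maxIdeal_smul hA hK ?_ (fun x => hker x x.2) ?_)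
    (regularityLE_truncIdeal hA hK j)
  -- A homogeneous `b ∈ 𝔪` of degree `d > 0` moves the kernel into its own component of degree `j +
  -- d > j`, which is zero.
  · intro a ha x
    suffices h : ∀ b : maxIdeal 𝒜, (b : A) • x = 0 from h ⟨a, ha⟩
    intro b
    have h := mem_iSup_maxIdealGrading b
    induction h using Submodule.iSup_induction' with
    | mem d b hb =>
      rcases Nat.eq_zero_or_pos d with rfl | hd
      · rw [eq_zero_of_mem_maxIdealGrading_zero hb, ZeroMemClass.coe_zero, zero_smul]
      · exact Subtype.ext (hz _ ((b : A) • x).2 (j + d) (by omega)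
          (isGradedSMul_symPowGrading j (show (b : A) ∈ 𝒜 d from hb) (hker x x.2)))
    | zero => rw [ZeroMemClass.coe_zero, zero_smul]
    | add b c _ _ hb hc => rw [Submodule.coe_add, add_smul, hb, hc, add_zero]
  · intro d hd x hx
    rcases lt_or_gt_of_ne hd with h | h
    · exact Subtype.ext (eq_zero_of_mem_symPowGrading h hx)
    · exact Subtype.ext (hz x x.2 d h hx)

/-- Whether `a` multiplies `x` as a new symmetric factor or as a scalar, the product in `A` is the
same. This passes from `S^{j+1}(𝔪)` down to `S^j(𝔪)`. -/
lemma symMul_barToSymPow (j : ℕ) (z : bar 𝒜 (SymPow 𝒜 j) 1) :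
    symMul 𝒜 (barToSymPow 𝒜 j z) = symMul 𝒜 (barToSymPowZero 𝒜 j (barD 𝒜 (SymPow 𝒜 j) 0 z)) := by
  induction z using bar_induction with
  | zero => rw [map_zero, map_zero, map_zero]; rfl
  | add y z hy hz => simp only [map_add, Submodule.coe_add, hy, hz]
  | mk y a =>
    obtain ⟨x, hx⟩ : ∃ x : SymPow 𝒜 j, symPowToBar 𝒜 j x = y := ⟨y, rfl⟩
    rw [← hx, barD_zero_mk, barAct_symPowToBar, barToSymPow_mk, coe_symCons, map_mul, symMul_ι]
    exact (map_smul (symMul 𝒜) (a : A) (x : SymmetricAlgebra A (maxIdeal 𝒜))).symm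

lemma symMul_injective [Nontrivial A] (hA : IsStandardGraded 𝒜)
    (hK : RegularityLE 𝒜 (residueGrading 𝒜) 0) (j : ℕ) :
    ∀ d, j < d → ∀ w ∈ symPowGrading 𝒜 j d, symMul 𝒜 w = 0 → w = 0 := by
  induction j with
  -- `S^0(𝔪)` is the image of `A`, on which multiplication inverts the structure map.
  | zero =>
    intro d _ w _ hw0
    obtain ⟨a, ha⟩ := Submodule.mem_one.mp
      (show (w : SymmetricAlgebra A (maxIdeal 𝒜)) ∈ (1 : Submodule A _) by simpa using w.2)
    ext
    rw [← ha, AlgHom.commutes] at hw0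
    rw [← ha, show a = 0 from hw0, map_zero, ZeroMemClass.coe_zero]
  | succ j ih =>
    intro d hd w hw hw0
    obtain ⟨z, hz, rfl⟩ := exists_barToSymPow_eq hw
    rw [symMul_barToSymPow] at hw0
    have hx0 : barD 𝒜 (SymPow 𝒜 j) 0 z = 0 :=
      ih d (by omega) _ (barD_mem (isGradedSMul_symPowGrading j) 0 d hz) hw0
    -- Vanishing of `Tor_1` needs `d > 1 + j`, exactly the range of degrees claimed for `j + 1`.
    obtain ⟨u, -, rfl⟩ := regularityLE_symPow_of_injective hA hK ih 1 d (by omega)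
      ⟨hz, hx0⟩
    exact barToSymPow_barD j u

lemma regularityLE_symPow [Nontrivial A] (hA : IsStandardGraded 𝒜)
    (hK : RegularityLE 𝒜 (residueGrading 𝒜) 0) (j : ℕ) :
    RegularityLE 𝒜 (symPowGrading 𝒜 j) j :=
  regularityLE_symPow_of_injective hA hK (symMul_injective hA hK j)

/-- If the degree `j` part vanished, so would its image `A_j`, hence all of `A_{≥j}`; injectivity
above degree `j` would then kill the rest of `S^j(𝔪)`. -/
lemma exists_mem_symPowGrading_ne_zero [Nontrivial A] (hA : IsStandardGraded 𝒜)
    (hK : RegularityLE 𝒜 (residueGrading 𝒜) 0) (j : ℕ) [Nontrivial (SymPow 𝒜 j)] :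
    symPowGrading 𝒜 j j ≠ ⊥ := by
  intro hbot
  have h𝒜 : ∀ d, 𝒜 (j + d) = ⊥ := by
    intro d
    induction d with
    | zero =>
      refine (Submodule.eq_bot_iff _).mpr fun x hx => ?_
      obtain ⟨w, hw, rfl⟩ := exists_symMul_eq hA j (j + 0) (by omega) hx
      rw [add_zero, hbot, Submodule.mem_bot] at hw
      rw [hw, ZeroMemClass.coe_zero, map_zero]
    | succ d ih =>
      have h := hA.le_mul (j + d)
      rw [ih, Submodule.mul_bot] at h
      exact le_bot_iff.mp h
  have h : ∀ d, symPowGrading 𝒜 j d = ⊥ := by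
    intro d
    refine (Submodule.eq_bot_iff _).mpr fun w hw => ?_
    rcases lt_trichotomy d j with h | rfl | h
    · exact eq_zero_of_mem_symPowGrading h hw
    · rwa [hbot, Submodule.mem_bot] at hw
    · obtain ⟨c, rfl⟩ := Nat.exists_eq_add_of_lt h
      have hw' := symMul_mem hw
      rw [add_assoc, h𝒜, Submodule.mem_bot] at hw'
      exact symMul_injective hA hK j _ h w hw hw'
  obtain ⟨w, hw⟩ := exists_ne (0 : SymPow 𝒜 j)
  have hw' := mem_iSup_symPowGrading w
  simp only [h, iSup_bot, Submodule.mem_bot] at hw'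
  exact hw hw'

end SymmetricPower

/-! ### From vanishing of Tor to the numerical regularity -/

section Regularity

variable {K : Type v} [Field K] {A : Type u} [CommRing A] [Algebra K A]
  {𝒜 : ℕ → Submodule K A} [GradedAlgebra 𝒜]
  {N : Type u} [AddCommGroup N] [Module K N] [Module A N] [IsScalarTower K A N]

lemma not_nontrivial_gradedTor_iff {𝒩 : ℕ → Submodule K N} {s d : ℕ} :
    ¬ Nontrivial (GradedTor 𝒜 𝒩 s d) ↔ torCycles 𝒜 𝒩 s d ≤ torBoundaries 𝒜 𝒩 s d := by
  rw [not_nontrivial_iff_subsingleton, Submodule.Quotient.subsingleton_iff,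
    Submodule.submoduleOf_eq_top]

lemma regularity_le_iff {𝒩 : ℕ → Submodule K N} {j : ℕ} :
    regularity 𝒜 𝒩 ≤ j ↔ RegularityLE 𝒜 𝒩 j := by
  simp only [regularity, topDegree, iSup_le_iff, RegularityLE, ← not_nontrivial_gradedTor_iff]
  refine forall_congr' fun s => ?_
  rw [EReal.sub_le_iff_le_add (.inl (EReal.natCast_ne_bot s)) (.inl (EReal.natCast_ne_top s)),
    iSup₂_le_iff]
  refine forall_congr' fun d => ?_
  rw [Set.mem_ofPred_eq, ← not_imp_not]
  norm_cast
  rw [not_le, add_comm]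

/-- Boundaries in `N_j` come from `N_e ⊗ 𝔪_f` with `e + f = j`; either `f = 0` and `𝔪_f = 0`, or `e
< j` and `N_e = 0`. So `Tor_0(N, K)_j` is all of `N_j`. -/
lemma le_regularity {𝒩 : ℕ → Submodule K N} {j : ℕ} (hj : 𝒩 j ≠ ⊥) (h : ∀ d < j, 𝒩 d = ⊥) :
    (j : EReal) ≤ regularity 𝒜 𝒩 := by
  have hnt : Nontrivial (GradedTor 𝒜 𝒩 0 j) := by
    by_contra hc
    rw [not_nontrivial_gradedTor_iff] at hc
    have hb : barGrading 𝒜 𝒩 1 j ≤ ⊥ := barGrading_succ_le fun e f hef w hw a ha => by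
      rw [Submodule.mem_bot]
      rcases Nat.eq_zero_or_pos f with rfl | hf
      · rw [eq_zero_of_mem_maxIdealGrading_zero ha, map_zero]
      · have hw : w ∈ 𝒩 e := hw
        rw [h e (by omega)] at hw
        rw [show w = 0 from hw, map_zero, LinearMap.zero_apply]
    refine hj ((Submodule.eq_bot_iff _).mpr fun x hx => ?_)
    obtain ⟨u, hu, hux⟩ := hc ⟨hx, trivial⟩
    rw [show u = 0 from hb hu, map_zero] at hux
    exact hux.symm
  refine le_trans ?_ (le_iSup _ 0)
  rw [Nat.cast_zero, sub_zero]
  exact le_iSup₂_of_le j hnt le_rfl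

end Regularity

end KoszulSym

end

theorem proposition3p5 {K : Type*} [Field K] {A : Type*} [CommRing A] [Nontrivial A]
    [Algebra K A] (𝒜 : ℕ → Submodule K A) [GradedAlgebra 𝒜]
    (hA : KoszulSym.IsStandardGraded 𝒜) (hKoszul : KoszulSym.IsKoszul 𝒜)
    (j : ℕ) (hj : 1 ≤ j) :
    KoszulSym.HasLinearResolution 𝒜 (KoszulSym.symPowGrading 𝒜 j) j := by
  have hK : KoszulSym.RegularityLE 𝒜 (KoszulSym.residueGrading 𝒜) 0 :=
    KoszulSym.regularity_le_iff.mp (hKoszul.le.trans_eq Nat.cast_zero.symm)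
  rcases subsingleton_or_nontrivial (KoszulSym.SymPow 𝒜 j) with h | h
  · exact .inl h
  · have h0 := KoszulSym.exists_mem_symPowGrading_ne_zero hA hK j
    have h1 : ∀ d < j, KoszulSym.symPowGrading 𝒜 j d = ⊥ := fun d hd =>
      (Submodule.eq_bot_iff _).mpr fun w hw => KoszulSym.eq_zero_of_mem_symPowGrading hd hw
    refine .inr ⟨le_antisymm (KoszulSym.regularity_le_iff.mpr
      (KoszulSym.regularityLE_symPow hA hK j)) (KoszulSym.le_regularity h0 h1), h0, fun d hd => ?_⟩
    by_contra hlt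
    exact hd (h1 d (not_le.mp hlt))
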